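/- Let $k$ be a field of characteristic $0$ and $K$ an algebraically closed extension field of $k$; varieties are defined over $k$ and points are $K$-points. Let $\mathbb P^{11}$ have homogeneous coordinates $a_{i,j}$ ($0\le i,j\le 3$, $i\ne j$), let $S_a=k[a_{i,j}]$, let $Q\subset\mathbb P^{11}$ be defined by the ideal $I(Q)$ generated by $$q_0=a_{1,2}a_{1,3}-a_{2,1}a_{2,3}+a_{3,1}a_{3,2},\quad q_1=a_{0,2}a_{0,3}-a_{3,0}a_{3,2}+a_{2,0}a_{2,3},$$ $$q_2=a_{1,0}a_{1,3}-a_{0,1}a_{0,3}+a_{3,0}a_{3,1},\quad q_3=a_{0,1}a_{0,2}-a_{1,0}a_{1,2}+a_{2,0}a_{2,1},$$ and let $I_4(a)$ be the ideal generated by the $4\times4$ minors of $$a=\begin{pmatrix}a_{0,1}&a_{0,2}&0&a_{0,3}&0&0\\ a_{1,0}&0&a_{1,2}&0&a_{1,3}&0\\ 0&a_{2,0}&a_{2,1}&0&0&a_{2,3}\\ 0&0&0&a_{3,0}&a_{3,1}&a_{3,2}\end{pmatrix}.$$ **Theorem 2.9.** The ideal $I_4(a)+I(Q)$ has exactly one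 minimal prime $J_{hyp}$ whose zero locus in $\mathbb P^{11}$ is 5-dimensional. The variety $V_{hyp}=V(J_{hyp})\subset\mathbb P^{11}$ (the hyperelliptic locus) is unirational over $k$. More precisely, let $F=\mathbb P(\mathcal O_{\mathbb P^1}\oplus\mathcal O_{\mathbb P^1}(2))$ be the Hirzebruch surface with homogeneous coordinates $v_0,v_1,w_0,w_1$ of bidegrees $(1,2),(1,0),(0,1),(0,1)$, and let $(x_0:x_1),(y_0:y_1),(z_0:z_1)$ be homogeneous coordinates on three copies of $\mathbb P^1$. Put $L=x_1w_1-x_0w_0$, $s=x_1+x_0$, $t=w_1+w_0$. Then the twelve forms $$\begin{aligned} a_{3,2}&=v_0^2Lx_1s\,y_0y_1z_1^2, & a_{3,1}&=v_0^2Lx_0s\,y_0y_1z_0^2, & a_{3,0}&=-v_1^2w_0^2w_1^2t\,x_0x_1s\,y_0y_1z_1^2,\\ a_{2,3}&=-v_0^2Lx_0x_1y_0^2z_1^2, & a_{2,1}&=-v_0^2Lx_0s\,y_1^2z_0^2, & a_{2,0}&=v_1^2w_0^2w_1t^2x_0x_1s\,y_1^2z_1^2,\\ a_{1,3}&=-v_0^2Lx_0x_1y_0^2z_0z_1,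 & a_{1,2}&=v_0^2Lx_1s\,y_1^2z_0z_1, & a_{1,0}&=-v_1^2w_0w_1^2t^2x_0x_1s\,y_1^2z_0z_1,\\ a_{0,3}&=-v_0v_1w_0w_1Lx_0x_1y_0^2z_1^2, & a_{0,2}&=v_0v_1w_0tLx_1s\,y_1^2z_1^2, & a_{0,1}&=-v_0v_1w_1tLx_0s\,y_1^2z_0^2 \end{aligned}$$ are multihomogeneous of one and the same multidegree, and the rational map $\varphi: F\times\mathbb P^1\times\mathbb P^1\times\mathbb P^1\dashrightarrow\mathbb P^{11}$ given by them maps every point at which they do not all vanish into $V_{hyp}$ and is a birational map, over $k$, onto $V_{hyp}$. -/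

import Mathlib

universe u v

/-! ### Varieties in (multi)homogeneous coordinates

The ambient varieties are projective spaces, Hirzebruch surfaces and products of these.  All of
them are given by homogeneous coordinates: `K`-points are vectors of coordinates which are nonzero
in every block of coordinates, modulo the action of a torus `(Kˣ)^ρ`. -/

/-- A system of homogeneous coordinates: `σ` indexes the coordinates, `ρ` indexes the factors of
the torus (and of the grading).  `weight s` is the multidegree of the coordinate `s`, and
`block s` is the block to which `s` belongs; the coordinates of a block may not vanish
simultaneously. -/
structure CoxData (σ ρ : Type) where
  weight : σ → ρ → ℕ
  block : σ → ρ

namespace CoxData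

/-- Projective space with homogeneous coordinates indexed by `ι`, all of degree one. -/
def proj (ι : Type) : CoxData ι Unit where
  weight := fun _ _ => 1
  block := fun _ => ()

/-- The Hirzebruch surface `ℙ(𝒪 ⊕ 𝒪(n))` over `ℙ¹`, with fibre coordinates
`v₀ = inl 0` of degree `(1, n)` and `v₁ = inl 1` of degree `(1, 0)`, and coordinates
`w₀ = inr 0`, `w₁ = inr 1` of the base, of degree `(0, 1)`.  So
`(v₀, v₁, w₀, w₁) ∼ (λ μⁿ v₀, λ v₁, μ w₀, μ w₁)`, where `(v₀, v₁) ≠ 0` and `(w₀, w₁) ≠ 0`. -/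
def hirzebruch (n : ℕ) : CoxData (Fin 2 ⊕ Fin 2) (Fin 2) where
  weight := Sum.elim ![![1, n], ![1, 0]] (fun _ => ![0, 1])
  block := Sum.elim (fun _ => 0) (fun _ => 1)

/-- The product of two varieties given by homogeneous coordinates. -/
def prod {σ ρ σ' ρ' : Type} (T : CoxData σ ρ) (T' : CoxData σ' ρ') :
    CoxData (σ ⊕ σ') (ρ ⊕ ρ') where
  weight := Sum.elim (fun s => Sum.elim (T.weight s) (fun _ => 0))
    (fun s => Sum.elim (fun _ => 0) (T'.weight s))
  block := Sum.elim (fun s => Sum.inl (T.block s)) (fun s => Sum.inr (T'.block s))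

variable {σ ρ σ' ρ' : Type} [Fintype ρ] [Fintype ρ']

/-- `u` is an admissible coordinate vector: in each block some coordinate is nonzero. -/
def IsCoord (T : CoxData σ ρ) {K : Type v} [Field K] (u : σ → K) : Prop :=
  ∀ i : ρ, ∃ s : σ, T.block s = i ∧ u s ≠ 0

/-- Two admissible coordinate vectors define the same point iff they differ by the torus action. -/
def setoid (T : CoxData σ ρ) (K : Type v) [Field K] : Setoid {u : σ → K // T.IsCoord u} where
  r x y := ∃ t : ρ → Kˣ, ∀ s, y.1 s = (∏ i, (t i : K) ^ T.weight s i) * x.1 s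
  iseqv :=
    { refl := fun x => ⟨fun _ => 1, fun s => by simp⟩
      symm := by
        rintro x y ⟨t, ht⟩
        refine ⟨fun i => (t i)⁻¹, fun s => ?_⟩
        rw [ht s, ← mul_assoc, ← Finset.prod_mul_distrib]
        simp
      trans := by
        rintro x y z ⟨t, ht⟩ ⟨t', ht'⟩
        refine ⟨fun i => t' i * t i, fun s => ?_⟩
        rw [ht' s, ht s, ← mul_assoc, ← Finset.prod_mul_distrib]
        simp [mul_pow] }

/-- The `K`-points of the variety. -/
def Point (T : CoxData σ ρ) (K : Type v) [Field K] : Type v := Quotient (T.setoid K)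

/-- `T.Represents u p`: the vector `u` is a vector of homogeneous coordinates of the point `p`. -/
def Represents (T : CoxData σ ρ) {K : Type v} [Field K] (u : σ → K) (p : T.Point K) : Prop :=
  ∃ h : T.IsCoord u, Quotient.mk (T.setoid K) ⟨u, h⟩ = p

section Zariski

variable (k : Type u) [Field k] {K : Type v} [Field K] [Algebra k K]

/-- Multihomogeneous polynomials of multidegree `d`. -/
def IsHomog {k : Type u} [Field k] (T : CoxData σ ρ) (f : MvPolynomial σ k) (d : ρ → ℕ) : Prop :=
  MvPolynomial.IsWeightedHomogeneous T.weight f d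

/-- The set of points at which all elements of an ideal vanish. -/
def zeroSet {k : Type u} [Field k] (T : CoxData σ ρ) (K : Type v) [Field K] [Algebra k K]
    (J : Ideal (MvPolynomial σ k)) : Set (T.Point K) :=
  {p | ∀ u, T.Represents u p → ∀ f ∈ J, MvPolynomial.aeval u f = 0}

/-- Zariski open sets (defined over `k`): complements of common zero sets of families of
multihomogeneous polynomials. -/
def IsZariskiOpen (T : CoxData σ ρ) (U : Set (T.Point K)) : Prop :=
  ∃ E : Set (MvPolynomial σ k), (∀ f ∈ E, ∃ d, T.IsHomog f d) ∧
    U = {p | ∃ f ∈ E, ∀ u, T.Represents u p → MvPolynomial.aeval u f ≠ 0}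

/-- A tuple `Φ` of multihomogeneous forms, indexed by the coordinates of the target `T'`, whose
multidegrees are compatible with the gradings: each grading factor `j` of the target is
assigned a multidegree `δ j` of the source.  For a target `ℙⁿ` this says that all
forms have the same multidegree. -/
def IsFormTuple {k : Type u} [Field k] (T : CoxData σ ρ) (T' : CoxData σ' ρ')
    (Φ : σ' → MvPolynomial σ k) : Prop :=
  ∃ δ : ρ' → ρ → ℕ, ∀ s, T.IsHomog (Φ s) (∑ j, T'.weight s j • δ j)

/-- The rational map given by the forms `Φ` is defined by these forms at `p`, with value `q`. -/
def MapsTo {k : Type u} [Field k] [Algebra k K] (T : CoxData σ ρ) (T' : CoxData σ' ρ')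
    (Φ : σ' → MvPolynomial σ k) (p : T.Point K) (q : T'.Point K) : Prop :=
  ∀ u, T.Represents u p → T'.Represents (fun s => MvPolynomial.aeval u (Φ s)) q

/-- A map between subsets of two such varieties is regular (over `k`) if locally, in the Zariski
topology, it is given by a compatible tuple of multihomogeneous forms. -/
def IsRegular (T : CoxData σ ρ) (T' : CoxData σ' ρ') {A : Set (T.Point K)} {B : Set (T'.Point K)}
    (g : A → B) : Prop :=
  ∀ p : A, ∃ U : Set (T.Point K), T.IsZariskiOpen k U ∧ p.1 ∈ U ∧
    ∃ Φ : σ' → MvPolynomial σ k, T.IsFormTuple T' Φ ∧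
      ∀ q : A, q.1 ∈ U → T.MapsTo T' Φ q.1 (g q).1

/-- The forms `Φ` define a birational map from the variety given by `T` to the irreducible
subvariety `V` of the variety given by `T'`: `Φ` is a compatible tuple of forms, and restricts to an
isomorphism (a bijection that is regular in both directions) from a nonempty open subset of the
source onto a nonempty open subset of `V`. -/
def IsBirationalMap {k : Type u} [Field k] [Algebra k K] (T : CoxData σ ρ) (T' : CoxData σ' ρ')
    (Φ : σ' → MvPolynomial σ k) (V : Set (T'.Point K)) : Prop :=
  T.IsFormTuple T' Φ ∧
  ∃ (U : Set (T.Point K)) (O : Set (T'.Point K)),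
    T.IsZariskiOpen k U ∧ T'.IsZariskiOpen k O ∧ U.Nonempty ∧ (V ∩ O).Nonempty ∧
    ∃ e : U ≃ ↥(V ∩ O),
      (∀ p : U, T.MapsTo T' Φ p.1 (e p).1) ∧
      T.IsRegular k T' e ∧ T'.IsRegular k T e.symm

/-- The subvariety `V` is unirational over `k`: there is a dominant rational map
`ℙⁿ ⇢ V` for some `n`, given by forms over `k`. -/
def IsUnirational (T' : CoxData σ' ρ') (V : Set (T'.Point K)) : Prop :=
  ∃ (n : ℕ) (Φ : σ' → MvPolynomial (Fin (n + 1)) k),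
    (proj (Fin (n + 1))).IsFormTuple T' Φ ∧
    (∃ (p : (proj (Fin (n + 1))).Point K) (q : T'.Point K),
      (proj (Fin (n + 1))).MapsTo T' Φ p q) ∧
    (∀ (p : (proj (Fin (n + 1))).Point K) (q : T'.Point K),
      (proj (Fin (n + 1))).MapsTo T' Φ p q → q ∈ V) ∧
    ∀ O : Set (T'.Point K), T'.IsZariskiOpen k O → (V ∩ O).Nonempty →
      ∃ (p : (proj (Fin (n + 1))).Point K) (q : T'.Point K),
        (proj (Fin (n + 1))).MapsTo T' Φ p q ∧ q ∈ O

end Zariski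

end CoxData

/-! ### The hyperelliptic locus -/

namespace HypLocus

section Ring

variable (k : Type u) [Field k]

/-- The polynomial ring in the twelve `a`-variables, which are ordered as
`a₃₂, a₃₁, a₃₀, a₂₃, a₂₁, a₂₀, a₁₃, a₁₂, a₁₀, a₀₃, a₀₂, a₀₁`. -/
abbrev Sa : Type u := MvPolynomial (Fin 12) k

noncomputable def a32 : Sa k := MvPolynomial.X 0
noncomputable def a31 : Sa k := MvPolynomial.X 1
noncomputable def a30 : Sa k := MvPolynomial.X 2
noncomputable def a23 : Sa k := MvPolynomial.X 3
noncomputable def a21 : Sa k := MvPolynomial.X 4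
noncomputable def a20 : Sa k := MvPolynomial.X 5
noncomputable def a13 : Sa k := MvPolynomial.X 6
noncomputable def a12 : Sa k := MvPolynomial.X 7
noncomputable def a10 : Sa k := MvPolynomial.X 8
noncomputable def a03 : Sa k := MvPolynomial.X 9
noncomputable def a02 : Sa k := MvPolynomial.X 10
noncomputable def a01 : Sa k := MvPolynomial.X 11

/-- The `a`-matrix. -/
noncomputable def aMatrix : Matrix (Fin 4) (Fin 6) (Sa k) :=
  !![a01 k, a02 k, 0,     a03 k, 0,     0;
     a10 k, 0,     a12 k, 0,     a13 k, 0;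
     0,     a20 k, a21 k, 0,     0,     a23 k;
     0,     0,     0,     a30 k, a31 k, a32 k]

/-- The ideal `I(Q)` generated by the four quadrics `q₀, q₁, q₂, q₃`. -/
noncomputable def idealQ : Ideal (Sa k) :=
  Ideal.span
    { a12 k * a13 k - a21 k * a23 k + a31 k * a32 k,
      a02 k * a03 k - a30 k * a32 k + a20 k * a23 k,
      a10 k * a13 k - a01 k * a03 k + a30 k * a31 k,
      a01 k * a02 k - a10 k * a12 k + a20 k * a21 k }

/-- The ideal `I₄(a)` generated by the `4 × 4` minors of the `a`-matrix. -/
noncomputable def idealMinors : Ideal (Sa k) :=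
  Ideal.span (Set.range fun c : Fin 4 → Fin 6 => ((aMatrix k).submatrix id c).det)

/-- `J` is the ideal `J_hyp` of a 5-dimensional irreducible component of the locus in `Q ⊂ ℙ¹¹`
where the `a`-matrix has rank at most three: a minimal prime of `I₄(a) + I(Q)` whose
zero locus in `ℙ¹¹` has dimension 5, that is, whose homogeneous coordinate ring has transcendence
degree `5 + 1` over `k`. -/
def IsHypIdeal (J : Ideal (Sa k)) : Prop :=
  J ∈ (idealMinors k ⊔ idealQ k).minimalPrimes ∧ Algebra.trdeg k (Sa k ⧸ J) = 5 + 1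

end Ring

/-- The projective space `ℙ¹¹` with the `a`-variables as homogeneous coordinates. -/
def P11 : CoxData (Fin 12) Unit := CoxData.proj (Fin 12)

/-- The product `F × ℙ¹ × ℙ¹ × ℙ¹` with `F = ℙ(𝒪 ⊕ 𝒪(2))`. -/
def FxP1xP1xP1 :
    CoxData ((Fin 2 ⊕ Fin 2) ⊕ Fin 2 ⊕ Fin 2 ⊕ Fin 2) (Fin 2 ⊕ Unit ⊕ Unit ⊕ Unit) :=
  (CoxData.hirzebruch 2).prod
    ((CoxData.proj (Fin 2)).prod ((CoxData.proj (Fin 2)).prod (CoxData.proj (Fin 2))))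

section Forms

variable (k : Type u) [Field k]

/-- The Cox ring of `F × ℙ¹ × ℙ¹ × ℙ¹`. -/
abbrev CoxRing : Type u := MvPolynomial ((Fin 2 ⊕ Fin 2) ⊕ Fin 2 ⊕ Fin 2 ⊕ Fin 2) k

noncomputable def v0 : CoxRing k := MvPolynomial.X (.inl (.inl 0))
noncomputable def v1 : CoxRing k := MvPolynomial.X (.inl (.inl 1))
noncomputable def w0 : CoxRing k := MvPolynomial.X (.inl (.inr 0))
noncomputable def w1 : CoxRing k := MvPolynomial.X (.inl (.inr 1))
noncomputable def x0 : CoxRing k := MvPolynomial.X (.inr (.inl 0))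
noncomputable def x1 : CoxRing k := MvPolynomial.X (.inr (.inl 1))
noncomputable def y0 : CoxRing k := MvPolynomial.X (.inr (.inr (.inl 0)))
noncomputable def y1 : CoxRing k := MvPolynomial.X (.inr (.inr (.inl 1)))
noncomputable def z0 : CoxRing k := MvPolynomial.X (.inr (.inr (.inr 0)))
noncomputable def z1 : CoxRing k := MvPolynomial.X (.inr (.inr (.inr 1)))

/-- The twelve forms defining `φ`, in the order
`a₃₂, a₃₁, a₃₀, a₂₃, a₂₁, a₂₀, a₁₃, a₁₂, a₁₀, a₀₃, a₀₂, a₀₁`. -/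
noncomputable def phi : Fin 12 → CoxRing k :=
  let v0 := v0 k
  let v1 := v1 k
  let w0 := w0 k
  let w1 := w1 k
  let x0 := x0 k
  let x1 := x1 k
  let y0 := y0 k
  let y1 := y1 k
  let z0 := z0 k
  let z1 := z1 k
  ![v0 ^ 2 * (x1 * w1 - x0 * w0) * x1 * (x1 + x0) * y0 * y1 * z1 ^ 2,
    v0 ^ 2 * (x1 * w1 - x0 * w0) * x0 * (x1 + x0) * y0 * y1 * z0 ^ 2,
    -(v1 ^ 2 * w0 ^ 2 * w1 ^ 2 * (w1 + w0) * x0 * x1 * (x1 + x0) * y0 * y1 * z1 ^ 2),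
    -(v0 ^ 2 * (x1 * w1 - x0 * w0) * x0 * x1 * y0 ^ 2 * z1 ^ 2),
    -(v0 ^ 2 * (x1 * w1 - x0 * w0) * x0 * (x1 + x0) * y1 ^ 2 * z0 ^ 2),
    v1 ^ 2 * w0 ^ 2 * w1 * (w1 + w0) ^ 2 * x0 * x1 * (x1 + x0) * y1 ^ 2 * z1 ^ 2,
    -(v0 ^ 2 * (x1 * w1 - x0 * w0) * x0 * x1 * y0 ^ 2 * z0 * z1),
    v0 ^ 2 * (x1 * w1 - x0 * w0) * x1 * (x1 + x0) * y1 ^ 2 * z0 * z1,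
    -(v1 ^ 2 * w0 * w1 ^ 2 * (w1 + w0) ^ 2 * x0 * x1 * (x1 + x0) * y1 ^ 2 * z0 * z1),
    -(v0 * v1 * w0 * w1 * (x1 * w1 - x0 * w0) * x0 * x1 * y0 ^ 2 * z1 ^ 2),
    v0 * v1 * w0 * (w1 + w0) * (x1 * w1 - x0 * w0) * x1 * (x1 + x0) * y1 ^ 2 * z1 ^ 2,
    -(v0 * v1 * w1 * (w1 + w0) * (x1 * w1 - x0 * w0) * x0 * (x1 + x0) * y1 ^ 2 * z0 ^ 2)]

end Forms

/-- The set of `K`-points of the projective variety `V(J) ⊂ ℙ¹¹`. -/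
def variety {k : Type u} [Field k] (K : Type v) [Field K] [Algebra k K] (J : Ideal (Sa k)) :
    Set (P11.Point K) :=
  P11.zeroSet K J

end HypLocus

namespace HypLocus

/-! ### Rank-deficient matrices -/

/-! The ideal sought is `hypIdeal`, the kernel of the substitution a ↦ φ, and everything rests on
inverting φ. Up to signs, a point satisfying the equations is an `IsConfig`: a 4×4 array with a
nonzero vector l such that l_i a_ij + l_j a_ji = 0, subject to one quadric per triple of indices. If
no a_ij vanishes, explicit monomials `psiVal` recover the Cox coordinates, and
`IsConfig.phiVal_psiVal` gives φ(ψ(a)) = c·a with c ≠ 0. This holds over every extension field of k,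
in particular at the generic point of a prime P containing I₄(a) + I(Q); hence `hypIdeal` ≤ P as
soon as P contains no variable.

If P contains a variable, a parameter count by the support of l (`generatedBy_of_eq_zero`) bounds
the transcendence degree of S_a/P by 5, while a 5-dimensional projective locus has a 6-dimensional
cone. Since `hypIdeal` contains the equations but no variable, and its quotient has transcendence
degree exactly 6, it is the only candidate (`isHypIdeal_iff`).

Birationality holds on the loci where all twelve coordinates are nonzero: there φ and ψ are mutually
inverse, the other composition being `exists_psiVal_phiVal`. For unirationality, replacing v₀ by a
cubic form turns φ into forms on ℙ⁹; dominance holds because `hypIdeal` consists of exactly the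
relations between the forms. -/

theorem exists_vecMul_eq_zero_of_minors {F : Type*} [Field F] {m n : ℕ}
    (M : Matrix (Fin m) (Fin n) F) (h : ∀ c : Fin m → Fin n, (M.submatrix id c).det = 0) :
    ∃ l : Fin m → F, l ≠ 0 ∧ ∀ j, ∑ i, l i * M i j = 0 := by
  set W : Submodule F (Fin m → F) := Submodule.span F (Set.range M.col) with hW
  have hlt : W < ⊤ := by
    rw [lt_top_iff_ne_top]
    intro htop
    -- If the columns spanned the whole space, some of them would form a basis, and the
    -- corresponding maximal minor would be nonzero.
    obtain ⟨κ, c, -, hspan, hli⟩ := exists_linearIndependent' F M.col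
    have hb : ⊤ ≤ Submodule.span F (Set.range (M.col ∘ c)) := by rw [hspan, ← hW, htop]
    let b := Module.Basis.mk hli hb
    let e : κ ≃ Fin m := b.indexEquiv (Pi.basisFun F (Fin m))
    have hli' : LinearIndependent F (M.submatrix id (c ∘ e.symm)).col :=
      hli.comp e.symm e.symm.injective
    rw [Matrix.linearIndependent_cols_iff_isUnit, Matrix.isUnit_iff_isUnit_det, h] at hli'
    exact not_isUnit_zero hli'
  obtain ⟨f, hf, hWf⟩ := Submodule.exists_le_ker_of_lt_top W hlt
  refine ⟨fun i => f (Pi.single i 1), fun h0 => hf ?_, fun j => ?_⟩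
  · ext i
    simpa using congrFun h0 i
  · have h1 : f (M.col j) = 0 := hWf (Submodule.subset_span ⟨j, rfl⟩)
    rw [LinearMap.pi_apply_eq_sum_univ f (M.col j)] at h1
    rw [← h1]
    refine Finset.sum_congr rfl fun i _ => ?_
    have hi : (Pi.single i 1 : Fin m → F) = fun j => if i = j then 1 else 0 := by
      ext j
      simp [Pi.single_apply, eq_comm]
    simp only [smul_eq_mul, mul_comm, hi, Matrix.col_apply]

/-! ### Symmetric form of the equations -/

/-- The equations of `Q` and of the rank condition, in coordinates whose signs are normalised so
that the symmetric group acts; `l` spans the left kernel of the `a`-matrix. -/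
structure IsConfig {F : Type*} [Field F] (a : Fin 4 → Fin 4 → F) (l : Fin 4 → F) : Prop where
  quad : ∀ i j m, i ≠ j → i ≠ m → j ≠ m → a i j * a i m + a j i * a j m + a m i * a m j = 0
  ker : ∀ i j, i ≠ j → l i * a i j + l j * a j i = 0

/-- The off-diagonal entries of `a` are rational functions over `k` of `n` elements. -/
def GeneratedBy (k : Type*) {F : Type*} [Field k] [Field F] [Algebra k F] (n : ℕ)
    (a : Fin 4 → Fin 4 → F) : Prop :=
  ∃ g : Fin n → F, ∀ L : IntermediateField k F, (∀ m, g m ∈ L) → ∀ i j, i ≠ j → a i j ∈ L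

/-! ### Parameter counts for configurations with a vanishing entry -/

section Degenerate

variable {k : Type*} {F : Type*} [Field k] [Field F] [Algebra k F]
  {a : Fin 4 → Fin 4 → F} {l : Fin 4 → F}

theorem IsConfig.perm (h : IsConfig a l) (σ : Equiv.Perm (Fin 4)) :
    IsConfig (fun i j => a (σ i) (σ j)) (fun i => l (σ i)) where
  quad i j m hij him hjm := h.quad _ _ _ (by simpa) (by simpa) (by simpa)
  ker i j hij := h.ker _ _ (by simpa)

theorem IsConfig.smul (h : IsConfig a l) (c : F) : IsConfig a (fun i => c * l i) where
  quad := h.quad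
  ker i j hij := by linear_combination c * h.ker i j hij

theorem GeneratedBy.of_perm {n : ℕ} (σ : Equiv.Perm (Fin 4))
    (h : GeneratedBy k n (fun i j => a (σ i) (σ j))) : GeneratedBy k n a := by
  obtain ⟨g, hg⟩ := h
  refine ⟨g, fun L hL i j hij => ?_⟩
  simpa using hg L hL (σ.symm i) (σ.symm j) (by simpa)

theorem GeneratedBy.of_five (x₀ x₁ x₂ x₃ x₄ : F)
    (h : ∀ L : IntermediateField k F, x₀ ∈ L → x₁ ∈ L → x₂ ∈ L → x₃ ∈ L → x₄ ∈ L →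
      (a 0 1 ∈ L ∧ a 0 2 ∈ L ∧ a 0 3 ∈ L) ∧ (a 1 0 ∈ L ∧ a 1 2 ∈ L ∧ a 1 3 ∈ L) ∧
      (a 2 0 ∈ L ∧ a 2 1 ∈ L ∧ a 2 3 ∈ L) ∧ (a 3 0 ∈ L ∧ a 3 1 ∈ L ∧ a 3 2 ∈ L)) :
    GeneratedBy k 5 a := by
  refine ⟨![x₀, x₁, x₂, x₃, x₄], fun L hL i j hij => ?_⟩
  obtain ⟨⟨h1, h2, h3⟩, ⟨h4, h5, h6⟩, ⟨h7, h8, h9⟩, ⟨h10, h11, h12⟩⟩ :=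
    h L (hL 0) (hL 1) (hL 2) (hL 3) (hL 4)
  fin_cases i <;> fin_cases j <;> first | assumption | exact absurd rfl hij

theorem mem_of_mul_add_eq_zero {L : IntermediateField k F} {x y z : F} (h : x * y + z = 0)
    (hx : x ≠ 0) (hxL : x ∈ L) (hzL : z ∈ L) : y ∈ L := by
  have : y = -z / x := by field_simp; linear_combination h
  rw [this]
  exact div_mem (neg_mem hzL) hxL

/-- The six entries on a triangle with non-vanishing kernel are generated by the kernel and two
further elements. -/
theorem exists_generators_triangle {p q r x x' y y' z z' : F} (hp : p ≠ 0) (hq : q ≠ 0)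
    (hr : r ≠ 0) (hx : p * x + q * x' = 0) (hy : p * y + r * y' = 0) (hz : q * z + r * z' = 0)
    (h : x * y + x' * z + y' * z' = 0) :
    ∃ g₁ g₂ : F, ∀ L : IntermediateField k F, p ∈ L → q ∈ L → r ∈ L → g₁ ∈ L → g₂ ∈ L →
      x ∈ L ∧ x' ∈ L ∧ y ∈ L ∧ y' ∈ L ∧ z ∈ L ∧ z' ∈ L := by
  have key : ∃ g₁ g₂ : F, ∀ L : IntermediateField k F, p ∈ L → q ∈ L → r ∈ L → g₁ ∈ L → g₂ ∈ L →
      x ∈ L ∧ y ∈ L ∧ z ∈ L := by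
    -- Eliminating x', y', z' leaves a quadric that is linear in x. If the coefficient of x
    -- vanishes, the quadric forces y = z = 0 and x alone remains; otherwise x is a rational
    -- function of y, z and the kernel.
    have h' : (r ^ 2 * (q * y - p * z)) * x + p * q ^ 2 * y * z = 0 := by
      have e1 : x' = -(p * x) / q := by field_simp; linear_combination hx
      have e2 : y' = -(p * y) / r := by field_simp; linear_combination hy
      have e3 : z' = -(q * z) / r := by field_simp; linear_combination hz
      rw [e1, e2, e3] at h
      field_simp at h
      linear_combination h
    by_cases hc : q * y - p * z = 0
    · have hyz : y * z = 0 := by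
        rw [hc] at h'
        simpa [hp, hq] using h'
      have hyz' : y = 0 ∧ z = 0 := by
        rcases mul_eq_zero.1 hyz with h0 | h0 <;> simp_all
      refine ⟨x, x, fun L _ _ _ h1 _ => ?_⟩
      simp [hyz', h1]
    · refine ⟨y, z, fun L h1 h2 h3 h4 h5 => ⟨?_, h4, h5⟩⟩
      refine mem_of_mul_add_eq_zero h' (by positivity) ?_ ?_
      · exact mul_mem (pow_mem h3 2) (sub_mem (mul_mem h2 h4) (mul_mem h1 h5))
      · exact mul_mem (mul_mem (mul_mem h1 (pow_mem h2 2)) h4) h5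
  obtain ⟨g₁, g₂, hg⟩ := key
  refine ⟨g₁, g₂, fun L h1 h2 h3 h4 h5 => ?_⟩
  obtain ⟨hxL, hyL, hzL⟩ := hg L h1 h2 h3 h4 h5
  exact ⟨hxL, mem_of_mul_add_eq_zero ((add_comm _ _).trans hx) hq h2 (mul_mem h1 hxL),
    hyL, mem_of_mul_add_eq_zero ((add_comm _ _).trans hy) hr h3 (mul_mem h1 hyL),
    hzL, mem_of_mul_add_eq_zero ((add_comm _ _).trans hz) hr h3 (mul_mem h2 hzL)⟩

/-- Nine entries remain, bound by four quadrics. Two of these give `a 1 2` and `a 1 3` after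
division by `a 1 0`; the case distinction makes the other two remove two further parameters. -/
theorem generatedBy_of_row_eq_zero_of_ne_zero (h : IsConfig a l) (h01 : a 0 1 = 0)
    (h02 : a 0 2 = 0) (h03 : a 0 3 = 0) (h10 : a 1 0 ≠ 0) : GeneratedBy k 5 a := by
  have q3 := h.quad 1 0 2 (by decide) (by decide) (by decide)
  have q2 := h.quad 1 0 3 (by decide) (by decide) (by decide)
  have q1 := h.quad 0 2 3 (by decide) (by decide) (by decide)
  have q0 := h.quad 1 2 3 (by decide) (by decide) (by decide)
  simp only [h01, h02, h03, mul_zero, add_zero, zero_add] at q1 q2 q3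
  have m12 : ∀ L : IntermediateField k F, a 1 0 ∈ L → a 2 0 ∈ L → a 2 1 ∈ L → a 1 2 ∈ L :=
    fun L h1 h2 h3 => mem_of_mul_add_eq_zero q3 h10 h1 (mul_mem h3 h2)
  have m13 : ∀ L : IntermediateField k F, a 1 0 ∈ L → a 3 0 ∈ L → a 3 1 ∈ L → a 1 3 ∈ L :=
    fun L h1 h2 h3 => mem_of_mul_add_eq_zero q2 h10 h1 (mul_mem h3 h2)
  have fin : ∀ x₁ x₂ x₃ x₄ : F, (∀ L : IntermediateField k F, a 1 0 ∈ L → x₁ ∈ L → x₂ ∈ L →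
      x₃ ∈ L → x₄ ∈ L →
      a 2 0 ∈ L ∧ a 2 1 ∈ L ∧ a 2 3 ∈ L ∧ a 3 0 ∈ L ∧ a 3 1 ∈ L ∧ a 3 2 ∈ L) →
      GeneratedBy k 5 a := by
    intro x₁ x₂ x₃ x₄ H
    refine .of_five (a 1 0) x₁ x₂ x₃ x₄ fun L h1 h2 h3 h4 h5 => ?_
    obtain ⟨h6, h7, h8, h9, h10, h11⟩ := H L h1 h2 h3 h4 h5
    have := m12 L h1 h6 h7
    have := m13 L h1 h9 h10
    simp [*]
  by_cases h20 : a 2 0 = 0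
  · simp only [h20, zero_mul, mul_zero, add_zero, zero_add] at q1 q3
    have h12 : a 1 2 = 0 := by simpa [h10] using q3
    simp only [h12, zero_mul, zero_add] at q0
    rcases mul_eq_zero.1 q1 with h0 | h0
    · by_cases h21 : a 2 1 = 0
      -- The final 0 fills a generator slot that this case does not need.
      · refine fin (a 2 3) (a 3 1) (a 3 2) 0 fun L _ _ _ _ _ => ?_
        simp [*]
      · refine fin (a 2 1) (a 3 1) (a 3 2) 0 fun L _ h1 h2 h3 _ => ?_
        have := mem_of_mul_add_eq_zero q0 h21 h1 (mul_mem h2 h3)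
        simp [*]
    · simp only [h0, mul_zero, add_zero] at q0
      rcases mul_eq_zero.1 q0 with h1 | h1
      · refine fin (a 2 3) (a 3 0) (a 3 1) 0 fun L _ _ _ _ _ => ?_
        simp [*]
      · refine fin (a 2 1) (a 3 0) (a 3 1) 0 fun L _ _ _ _ _ => ?_
        simp [*]
  · have m23 : ∀ L : IntermediateField k F, a 2 0 ∈ L → a 3 0 ∈ L → a 3 2 ∈ L → a 2 3 ∈ L :=
      fun L h1 h2 h3 => mem_of_mul_add_eq_zero q1 h20 h1 (mul_mem h2 h3)
    -- With `a 1 2`, `a 1 3`, `a 2 3` eliminated, the last quadric is linear in `a 2 1`. If its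
    -- coefficient vanishes, `a 3 1` or `a 3 2` is zero, which saves a parameter just as well.
    have key : a 2 1 * (a 3 0 * (a 2 0 ^ 2 * a 3 1 - a 1 0 ^ 2 * a 3 2))
        + a 1 0 ^ 2 * a 2 0 * (a 3 1 * a 3 2) = 0 := by
      have e1 : a 1 2 = -(a 2 1 * a 2 0) / a 1 0 := by field_simp; linear_combination q3
      have e2 : a 1 3 = -(a 3 1 * a 3 0) / a 1 0 := by field_simp; linear_combination q2
      have e3 : a 2 3 = -(a 3 0 * a 3 2) / a 2 0 := by field_simp; linear_combination q1
      rw [e1, e2, e3] at q0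
      field_simp at q0
      linear_combination q0
    by_cases hc : a 3 0 * (a 2 0 ^ 2 * a 3 1 - a 1 0 ^ 2 * a 3 2) = 0
    · rw [hc] at key
      have h3 : a 3 1 * a 3 2 = 0 := by simpa [h10, h20] using key
      rcases mul_eq_zero.1 h3 with h0 | h0
      · refine fin (a 2 0) (a 3 0) (a 2 1) (a 3 2) fun L _ h1 h2 _ h4 => ?_
        have := m23 L h1 h2 h4
        simp [*]
      · refine fin (a 2 0) (a 3 0) (a 2 1) (a 3 1) fun L _ h1 h2 _ _ => ?_
        have := m23 L h1 h2 (by simp [h0])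
        simp [*]
    · refine fin (a 2 0) (a 3 0) (a 3 1) (a 3 2) fun L h0 h1 h2 h3 h4 => ?_
      have := m23 L h1 h2 h4
      have : a 2 1 ∈ L := by
        rw [mul_comm (a 2 1)] at key
        refine mem_of_mul_add_eq_zero key hc ?_ ?_
        · exact mul_mem h2 (sub_mem (mul_mem (pow_mem h1 2) h3) (mul_mem (pow_mem h0 2) h4))
        · exact mul_mem (mul_mem (pow_mem h0 2) h1) (mul_mem h3 h4)
      simp [*]

/-- A nonzero entry of column 0 can be moved to position (1, 0) by a transposition fixing 0. If
column 0 vanishes too, only six entries and one quadric are left. -/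
theorem generatedBy_of_row_eq_zero (h : IsConfig a l) (h01 : a 0 1 = 0) (h02 : a 0 2 = 0)
    (h03 : a 0 3 = 0) : GeneratedBy k 5 a := by
  by_cases hne : ∃ j, j ≠ 0 ∧ a j 0 ≠ 0
  · obtain ⟨j, hj, hne⟩ := hne
    have h0 : ∀ i, i ≠ 0 → a 0 i = 0 := by
      intro i hi
      fin_cases i <;> simp_all
    have hs : Equiv.swap 1 j 0 = 0 := Equiv.swap_apply_of_ne_of_ne (by decide) hj.symm
    refine .of_perm (Equiv.swap 1 j)
      (generatedBy_of_row_eq_zero_of_ne_zero (h.perm _) ?_ ?_ ?_ ?_)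
    all_goals simp only [hs]
    iterate 3
      refine h0 _ fun h => ?_
      rw [← hs] at h
      exact absurd ((Equiv.swap 1 j).injective h) (by decide)
    simpa using hne
  · push Not at hne
    have h10 := hne 1 (by decide)
    have h20 := hne 2 (by decide)
    have h30 := hne 3 (by decide)
    have q0 := h.quad 1 2 3 (by decide) (by decide) (by decide)
    by_cases h12 : a 1 2 = 0
    · refine .of_five (a 1 3) (a 2 1) (a 2 3) (a 3 1) (a 3 2) fun L _ _ _ _ _ => ?_
      simp [*]
    · refine .of_five (a 1 2) (a 2 1) (a 2 3) (a 3 1) (a 3 2) fun L h1 h2 h3 h4 h5 => ?_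
      rw [add_assoc] at q0
      have := mem_of_mul_add_eq_zero q0 h12 h1 (add_mem (mul_mem h2 h3) (mul_mem h4 h5))
      simp [*]

/-- The kernel relations kill the four entries from {0, 1} to {2, 3}. Of the eight others, two
vanish because two quadrics become monomials, and the remaining quadrics remove one more parameter.
-/
theorem generatedBy_of_ker_two (h : IsConfig a l) (hl0 : l 0 ≠ 0) (hl1 : l 1 ≠ 0)
    (hl2 : l 2 = 0) (hl3 : l 3 = 0) : GeneratedBy k 5 a := by
  have h02 : a 0 2 = 0 := by simpa [hl0, hl2] using h.ker 0 2 (by decide)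
  have h03 : a 0 3 = 0 := by simpa [hl0, hl3] using h.ker 0 3 (by decide)
  have h12 : a 1 2 = 0 := by simpa [hl1, hl2] using h.ker 1 2 (by decide)
  have h13 : a 1 3 = 0 := by simpa [hl1, hl3] using h.ker 1 3 (by decide)
  have q3 := h.quad 0 1 2 (by decide) (by decide) (by decide)
  have q2 := h.quad 0 1 3 (by decide) (by decide) (by decide)
  have q1 := h.quad 0 2 3 (by decide) (by decide) (by decide)
  have q0 := h.quad 1 2 3 (by decide) (by decide) (by decide)
  simp only [h02, h03, h12, h13, mul_zero, add_zero, zero_add] at q0 q1 q2 q3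
  rcases mul_eq_zero.1 q2 with h30 | h31 <;> rcases mul_eq_zero.1 q3 with h20 | h21
  · by_cases h21 : a 2 1 = 0
    · refine .of_five (a 0 1) (a 1 0) (a 2 3) (a 3 1) (a 3 2) fun L _ _ _ _ _ => ?_
      simp [*]
    · refine .of_five (a 0 1) (a 1 0) (a 2 1) (a 3 1) (a 3 2) fun L _ _ h1 h2 h3 => ?_
      have := mem_of_mul_add_eq_zero q0 h21 h1 (mul_mem h2 h3)
      simp [*]
  · simp only [h30, h21, zero_mul, add_zero, zero_add] at q0 q1
    rcases mul_eq_zero.1 q0 with h1 | h1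
    · refine .of_five (a 0 1) (a 1 0) (a 2 0) (a 3 2) (a 2 3) fun L _ _ _ _ _ => ?_
      simp [*]
    · refine .of_five (a 0 1) (a 1 0) (a 2 0) (a 3 1) (a 2 3) fun L _ _ _ _ _ => ?_
      simp [*]
  · simp only [h31, h20, zero_mul, add_zero, zero_add] at q0 q1
    rcases mul_eq_zero.1 q0 with h1 | h1
    · refine .of_five (a 0 1) (a 1 0) (a 3 0) (a 3 2) (a 2 3) fun L _ _ _ _ _ => ?_
      simp [*]
    · refine .of_five (a 0 1) (a 1 0) (a 3 0) (a 3 2) (a 2 1) fun L _ _ _ _ _ => ?_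
      simp [*]
  · by_cases h20 : a 2 0 = 0
    · refine .of_five (a 0 1) (a 1 0) (a 2 3) (a 3 0) (a 3 2) fun L _ _ _ _ _ => ?_
      simp [*]
    · refine .of_five (a 0 1) (a 1 0) (a 2 0) (a 3 0) (a 3 2) fun L _ _ h1 h2 h3 => ?_
      have := mem_of_mul_add_eq_zero q1 h20 h1 (mul_mem h2 h3)
      simp [*]

/-- Column 3 vanishes, so the entries of row 3 have pairwise zero products and cost one parameter.
The triangle on 0, 1, 2 costs two, besides l₁ and l₂. -/
theorem generatedBy_of_ker_three (h : IsConfig a l) (hl0 : l 0 = 1) (hl1 : l 1 ≠ 0)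
    (hl2 : l 2 ≠ 0) (hl3 : l 3 = 0) : GeneratedBy k 5 a := by
  have h03 : a 0 3 = 0 := by simpa [hl0, hl3] using h.ker 0 3 (by decide)
  have h13 : a 1 3 = 0 := by simpa [hl1, hl3] using h.ker 1 3 (by decide)
  have h23 : a 2 3 = 0 := by simpa [hl2, hl3] using h.ker 2 3 (by decide)
  have q3 := h.quad 0 1 2 (by decide) (by decide) (by decide)
  have q2 := h.quad 0 1 3 (by decide) (by decide) (by decide)
  have q1 := h.quad 0 2 3 (by decide) (by decide) (by decide)
  have q0 := h.quad 1 2 3 (by decide) (by decide) (by decide)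
  simp only [h03, h13, h23, mul_zero, add_zero, zero_add] at q0 q1 q2
  obtain ⟨g₁, g₂, hg⟩ := exists_generators_triangle (k := k) (by simp [hl0]) hl1 hl2
    (h.ker 0 1 (by decide)) (h.ker 0 2 (by decide)) (h.ker 1 2 (by decide)) q3
  obtain ⟨g₃, hg₃⟩ : ∃ g₃ : F, ∀ L : IntermediateField k F, g₃ ∈ L →
      a 3 0 ∈ L ∧ a 3 1 ∈ L ∧ a 3 2 ∈ L := by
    by_cases h30 : a 3 0 = 0
    · rcases mul_eq_zero.1 q0 with h1 | h1
      · exact ⟨a 3 2, fun L hL => by simp [*]⟩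
      · exact ⟨a 3 1, fun L hL => by simp [*]⟩
    · have h31 : a 3 1 = 0 := by simpa [h30] using q2
      have h32 : a 3 2 = 0 := by simpa [h30] using q1
      exact ⟨a 3 0, fun L hL => by simp [*]⟩
  refine .of_five (l 1) (l 2) g₁ g₂ g₃ fun L h1 h2 h4 h5 h6 => ?_
  have := hg L (by simp [hl0, one_mem]) h1 h2 h4 h5
  have := hg₃ L h6
  simp [*]

/-- Now a_ij and a_ji determine each other over the field of l, so l costs three parameters and each
edge {i, j} at most one. With edge {0, 1} gone, the monomial quadrics leave either a triangle,
costing two, or at most two edges. -/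
theorem generatedBy_of_ker_four (h : IsConfig a l) (hl0 : l 0 = 1) (hl1 : l 1 ≠ 0)
    (hl2 : l 2 ≠ 0) (hl3 : l 3 ≠ 0) (h01 : a 0 1 = 0) : GeneratedBy k 5 a := by
  have hl : ∀ i, l i ≠ 0 := by intro i; fin_cases i <;> simp [*]
  have symm0 : ∀ i j, i ≠ j → a i j = 0 → a j i = 0 := fun i j hij h0 => by
    simpa [h0, hl] using h.ker i j hij
  have h10 := symm0 0 1 (by decide) h01
  have q3 := h.quad 0 1 2 (by decide) (by decide) (by decide)
  have q2 := h.quad 0 1 3 (by decide) (by decide) (by decide)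
  have q1 := h.quad 0 2 3 (by decide) (by decide) (by decide)
  have q0 := h.quad 1 2 3 (by decide) (by decide) (by decide)
  simp only [h01, h10, zero_mul, add_zero, zero_add] at q0 q1 q2 q3
  have m : ∀ (L : IntermediateField k F) (i j), i ≠ j → l i ∈ L → l j ∈ L → a i j ∈ L →
      a j i ∈ L := fun L i j hij h1 h2 h3 =>
    mem_of_mul_add_eq_zero ((add_comm _ _).trans (h.ker i j hij)) (hl j) h2 (mul_mem h1 h3)
  have m0 : ∀ L : IntermediateField k F, l 0 ∈ L := fun L => by simp [hl0, one_mem]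
  rcases mul_eq_zero.1 q3 with h20 | h21 <;> rcases mul_eq_zero.1 q2 with h30 | h31
  · have h02 := symm0 2 0 (by decide) h20
    have h03 := symm0 3 0 (by decide) h30
    obtain ⟨g₁, g₂, hg⟩ := exists_generators_triangle (k := k) hl1 hl2 hl3
      (h.ker 1 2 (by decide)) (h.ker 1 3 (by decide)) (h.ker 2 3 (by decide)) q0
    refine .of_five (l 1) (l 2) (l 3) g₁ g₂ fun L h1 h2 h3 h4 h5 => ?_
    have := hg L h1 h2 h3 h4 h5
    simp [*]
  · have h02 := symm0 2 0 (by decide) h20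
    have h13 := symm0 3 1 (by decide) h31
    simp only [h02, h20, zero_mul, zero_add] at q1
    rcases mul_eq_zero.1 q1 with h30 | h32
    · have h03 := symm0 3 0 (by decide) h30
      refine .of_five (l 1) (l 2) (l 3) (a 1 2) (a 2 3) fun L h1 h2 h3 h4 h5 => ?_
      have := m L 1 2 (by decide) h1 h2 h4
      have := m L 2 3 (by decide) h2 h3 h5
      simp [*]
    · have h23 := symm0 3 2 (by decide) h32
      refine .of_five (l 1) (l 2) (l 3) (a 1 2) (a 0 3) fun L h1 h2 h3 h4 h5 => ?_
      have := m L 1 2 (by decide) h1 h2 h4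
      have := m L 0 3 (by decide) (m0 L) h3 h5
      simp [*]
  · have h12 := symm0 2 1 (by decide) h21
    have h03 := symm0 3 0 (by decide) h30
    simp only [h12, h21, zero_mul, zero_add] at q0
    rcases mul_eq_zero.1 q0 with h31 | h32
    · have h13 := symm0 3 1 (by decide) h31
      refine .of_five (l 1) (l 2) (l 3) (a 0 2) (a 2 3) fun L h1 h2 h3 h4 h5 => ?_
      have := m L 0 2 (by decide) (m0 L) h2 h4
      have := m L 2 3 (by decide) h2 h3 h5
      simp [*]
    · have h23 := symm0 3 2 (by decide) h32
      refine .of_five (l 1) (l 2) (l 3) (a 0 2) (a 1 3) fun L h1 h2 h3 h4 h5 => ?_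
      have := m L 0 2 (by decide) (m0 L) h2 h4
      have := m L 1 3 (by decide) h1 h3 h5
      simp [*]
  · have h12 := symm0 2 1 (by decide) h21
    have h13 := symm0 3 1 (by decide) h31
    obtain ⟨g₁, g₂, hg⟩ := exists_generators_triangle (k := k) (hl 0) hl2 hl3
      (h.ker 0 2 (by decide)) (h.ker 0 3 (by decide)) (h.ker 2 3 (by decide)) q1
    refine .of_five (l 1) (l 2) (l 3) g₁ g₂ fun L h1 h2 h3 h4 h5 => ?_
    have := hg L (m0 L) h2 h3 h4 h5
    simp [*]

theorem exists_perm_apply_zero_one {i j : Fin 4} (hij : i ≠ j) :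
    ∃ σ : Equiv.Perm (Fin 4), σ 0 = i ∧ σ 1 = j := by
  revert i j
  decide

/-- Configurations with a vanishing off-diagonal entry depend on at most five parameters. -/
theorem generatedBy_of_eq_zero (h : IsConfig a l) (hl : l ≠ 0) {i j : Fin 4} (hij : i ≠ j)
    (h0 : a i j = 0) : GeneratedBy k 5 a := by
  by_cases hall : ∀ m, l m ≠ 0
  · obtain ⟨σ, h1, h2⟩ := exists_perm_apply_zero_one hij
    refine .of_perm σ (generatedBy_of_ker_four ((h.perm σ).smul (l (σ 0))⁻¹) ?_ ?_ ?_ ?_ ?_)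
    · exact inv_mul_cancel₀ (hall _)
    iterate 3 exact mul_ne_zero (inv_ne_zero (hall _)) (hall _)
    simpa [h1, h2]
  · obtain ⟨i₀, hi₀⟩ := not_forall.1 hall
    obtain ⟨i₁, hi₁⟩ := Function.ne_iff.1 hl
    classical
    let f : Fin 4 → ℕ := fun i => if l i = 0 then 1 else 0
    -- Sorting moves the zeros of l to the end, so the support becomes an initial segment and its
    -- size selects the case. A support of size one makes row 0 vanish.
    set σ := Tuple.sort f with hσ
    have hmono : Monotone (f ∘ σ) := Tuple.monotone_sort f
    have hz : ∀ i j, i ≤ j → l (σ i) = 0 → l (σ j) = 0 := by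
      intro i j hle hi
      have := hmono hle
      by_contra hj
      simp [f, hi, hj] at this
    have hs0 : l (σ 0) ≠ 0 := fun h' => hi₁ (by simpa using hz 0 (σ.symm i₁) (Fin.zero_le _) h')
    have hs3 : l (σ 3) = 0 := hz (σ.symm i₀) 3 (Fin.le_last _) (by simpa using hi₀)
    refine .of_perm σ ?_
    have hc := h.perm σ
    by_cases hs1 : l (σ 1) = 0
    · have hs2 := hz 1 2 (by decide) hs1
      refine generatedBy_of_row_eq_zero hc ?_ ?_ ?_
      · simpa [hs0, hs1] using hc.ker 0 1 (by decide)
      · simpa [hs0, hs2] using hc.ker 0 2 (by decide)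
      · simpa [hs0, hs3] using hc.ker 0 3 (by decide)
    · by_cases hs2 : l (σ 2) = 0
      · exact generatedBy_of_ker_two hc hs0 hs1 hs2 hs3
      · exact generatedBy_of_ker_three (hc.smul (l (σ 0))⁻¹) (inv_mul_cancel₀ hs0)
          (mul_ne_zero (inv_ne_zero hs0) hs1) (mul_ne_zero (inv_ne_zero hs0) hs2)
          (by simp [hs3])

end Degenerate

/-! ### The parametrisation and its inverse in coordinates -/

/-- The index type of the coordinates of `F × ℙ¹ × ℙ¹ × ℙ¹`. -/
abbrev CoxIndex : Type := (Fin 2 ⊕ Fin 2) ⊕ Fin 2 ⊕ Fin 2 ⊕ Fin 2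

section Coordinates

variable {R : Type*}

/-- The coordinate vector with the given entries. -/
def coxVec (v₀ v₁ w₀ w₁ x₀ x₁ y₀ y₁ z₀ z₁ : R) : CoxIndex → R :=
  Sum.elim (Sum.elim ![v₀, v₁] ![w₀, w₁]) (Sum.elim ![x₀, x₁] (Sum.elim ![y₀, y₁] ![z₀, z₁]))

theorem forall_coxIndex {P : CoxIndex → Prop} :
    (∀ s, P s) ↔ (P (.inl (.inl 0)) ∧ P (.inl (.inl 1))) ∧ (P (.inl (.inr 0)) ∧ P (.inl (.inr 1))) ∧
      (P (.inr (.inl 0)) ∧ P (.inr (.inl 1))) ∧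
      (P (.inr (.inr (.inl 0))) ∧ P (.inr (.inr (.inl 1)))) ∧
      (P (.inr (.inr (.inr 0))) ∧ P (.inr (.inr (.inr 1)))) := by
  simp [Sum.forall, Fin.forall_fin_two]
  tauto

theorem eq_coxVec (u : CoxIndex → R) : u = coxVec (u (.inl (.inl 0))) (u (.inl (.inl 1)))
    (u (.inl (.inr 0))) (u (.inl (.inr 1))) (u (.inr (.inl 0))) (u (.inr (.inl 1)))
    (u (.inr (.inr (.inl 0)))) (u (.inr (.inr (.inl 1)))) (u (.inr (.inr (.inr 0))))
    (u (.inr (.inr (.inr 1)))) := by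
  rw [funext_iff, forall_coxIndex]
  exact ⟨⟨rfl, rfl⟩, ⟨rfl, rfl⟩, ⟨rfl, rfl⟩, ⟨rfl, rfl⟩, ⟨rfl, rfl⟩⟩

variable [CommRing R]

/-- The twelve monomials in the Cox coordinates and `L`, `s`, `t` that define `φ`. -/
def phiMonomials (v₀ v₁ w₀ w₁ x₀ x₁ y₀ y₁ z₀ z₁ L s t : R) : Fin 12 → R :=
  ![v₀ ^ 2 * L * x₁ * s * y₀ * y₁ * z₁ ^ 2,
    v₀ ^ 2 * L * x₀ * s * y₀ * y₁ * z₀ ^ 2,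
    -(v₁ ^ 2 * w₀ ^ 2 * w₁ ^ 2 * t * x₀ * x₁ * s * y₀ * y₁ * z₁ ^ 2),
    -(v₀ ^ 2 * L * x₀ * x₁ * y₀ ^ 2 * z₁ ^ 2),
    -(v₀ ^ 2 * L * x₀ * s * y₁ ^ 2 * z₀ ^ 2),
    v₁ ^ 2 * w₀ ^ 2 * w₁ * t ^ 2 * x₀ * x₁ * s * y₁ ^ 2 * z₁ ^ 2,
    -(v₀ ^ 2 * L * x₀ * x₁ * y₀ ^ 2 * z₀ * z₁),
    v₀ ^ 2 * L * x₁ * s * y₁ ^ 2 * z₀ * z₁,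
    -(v₁ ^ 2 * w₀ * w₁ ^ 2 * t ^ 2 * x₀ * x₁ * s * y₁ ^ 2 * z₀ * z₁),
    -(v₀ * v₁ * w₀ * w₁ * L * x₀ * x₁ * y₀ ^ 2 * z₁ ^ 2),
    v₀ * v₁ * w₀ * t * L * x₁ * s * y₁ ^ 2 * z₁ ^ 2,
    -(v₀ * v₁ * w₁ * t * L * x₀ * s * y₁ ^ 2 * z₀ ^ 2)]

/-- The values of the forms `phi`. -/
def phiVal (u : CoxIndex → R) : Fin 12 → R :=
  phiMonomials (u (.inl (.inl 0))) (u (.inl (.inl 1)))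
    (u (.inl (.inr 0))) (u (.inl (.inr 1))) (u (.inr (.inl 0))) (u (.inr (.inl 1)))
    (u (.inr (.inr (.inl 0)))) (u (.inr (.inr (.inl 1)))) (u (.inr (.inr (.inr 0))))
    (u (.inr (.inr (.inr 1))))
    (u (.inr (.inl 1)) * u (.inl (.inr 1)) - u (.inr (.inl 0)) * u (.inl (.inr 0)))
    (u (.inr (.inl 1)) + u (.inr (.inl 0))) (u (.inl (.inr 1)) + u (.inl (.inr 0)))

theorem aeval_phi {k : Type*} [Field k] [Algebra k R] (u : CoxIndex → R) (i : Fin 12) :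
    MvPolynomial.aeval u (phi k i) = phiVal u i := by
  fin_cases i <;> simp [phi, phiVal, phiMonomials, v0, v1, w0, w1, x0, x1, y0, y1, z0, z1]

/-- The inverse of `φ`: coordinates on `F × ℙ¹ × ℙ¹ × ℙ¹` as functions of the `a`-variables. -/
def psiVal (a : Fin 12 → R) : CoxIndex → R :=
  -- The ratios come from quotients of the forms: z₀/z₁ = a₁₃/a₂₃, y₀/y₁ = -a₃₁/a₂₁, and x₀/x₁ from
  -- a₃₁/a₃₂ once z is known. Then w₀/w₁ = -a₀₂a₃₁/(a₀₁a₃₂), and v₀/v₁ = w₀w₁a₂₃/a₀₃ for the chosen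
  -- representatives of w.
  coxVec (-(a 3 * a 10 * a 1 * a 11 * a 0)) (a 9) (-(a 10 * a 1)) (a 11 * a 0)
    (a 1 * a 3 ^ 2) (a 0 * a 6 ^ 2) (a 1) (-a 4) (a 6) (a 3)

/-- The forms defining the inverse of `φ`. -/
noncomputable def psi (k : Type*) [Field k] : CoxIndex → Sa k := psiVal MvPolynomial.X

theorem aeval_psi {k : Type*} [Field k] [Algebra k R] (a : Fin 12 → R) :
    (fun s => MvPolynomial.aeval a (psi k s)) = psiVal a := by
  rw [funext_iff, forall_coxIndex]
  simp [psi, psiVal, coxVec]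

/-- The `a`-variables arranged as a matrix, with signs that make the quadrics symmetric. -/
def signedMatrix (a : Fin 12 → R) : Fin 4 → Fin 4 → R :=
  ![![0, a 11, -a 10, a 9], ![a 8, 0, a 7, -a 6], ![-a 5, a 4, 0, a 3], ![a 2, -a 1, a 0, 0]]

end Coordinates

section Field

variable {F : Type*} [Field F]

/-- The action of a one-parameter subgroup of the torus under which `φ` has degree one. -/
def scaleVec (c : F) (u : CoxIndex → F) : CoxIndex → F :=
  coxVec (c⁻¹ * u (.inl (.inl 0))) (c⁻¹ * u (.inl (.inl 1)))
    (u (.inl (.inr 0))) (u (.inl (.inr 1))) (c * u (.inr (.inl 0))) (c * u (.inr (.inl 1)))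
    (u (.inr (.inr (.inl 0)))) (u (.inr (.inr (.inl 1)))) (u (.inr (.inr (.inr 0))))
    (u (.inr (.inr (.inr 1))))

theorem phiVal_coxVec_scale (c d v₀ v₁ w₀ w₁ x₀ x₁ y₀ y₁ z₀ z₁ : F) :
    phiVal (coxVec (d * v₀) (d * v₁) w₀ w₁ (c * x₀) (c * x₁) y₀ y₁ z₀ z₁) =
      (c ^ 3 * d ^ 2) • phiVal (coxVec v₀ v₁ w₀ w₁ x₀ x₁ y₀ y₁ z₀ z₁) := by
  ext i
  fin_cases i <;> simp [phiVal, phiMonomials, coxVec] <;> ring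

/-- The forms have degree 3 in x and 2 in v, and 3 - 2 = 1. Any scalar can therefore be absorbed
into the Cox coordinates without extracting roots. -/
theorem phiVal_scaleVec {c : F} (hc : c ≠ 0) (u : CoxIndex → F) :
    phiVal (scaleVec c u) = c • phiVal u := by
  refine (phiVal_coxVec_scale _ _ _ _ _ _ _ _ _ _ _ _).trans ?_
  rw [← eq_coxVec u]
  congr 1
  field_simp

theorem phiVal_coxVec_mul (v v₁ w w₁ x x₁ y y₁ z z₁ : F) :
    phiVal (coxVec (v * (v₁ * w₁ ^ 2)) v₁ (w * w₁) w₁ (x * x₁) x₁ (y * y₁) y₁ (z * z₁) z₁) =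
      (v₁ ^ 2 * w₁ ^ 5 * x₁ ^ 3 * y₁ ^ 2 * z₁ ^ 2) • phiVal (coxVec v 1 w 1 x 1 y 1 z 1) := by
  ext i
  fin_cases i <;> simp [phiVal, phiMonomials, coxVec] <;> ring

theorem phiVal_dehomogenize (u : CoxIndex → F) (hv : u (.inl (.inl 1)) ≠ 0)
    (hw : u (.inl (.inr 1)) ≠ 0) (hx : u (.inr (.inl 1)) ≠ 0) (hy : u (.inr (.inr (.inl 1))) ≠ 0)
    (hz : u (.inr (.inr (.inr 1))) ≠ 0) :
    ∃ c v w x y z : F, phiVal u = c • phiVal (coxVec v 1 w 1 x 1 y 1 z 1) := by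
  refine ⟨_, _, _, _, _, _, .trans (congrArg phiVal ?_) (phiVal_coxVec_mul
    (u (.inl (.inl 0)) / (u (.inl (.inl 1)) * u (.inl (.inr 1)) ^ 2)) (u (.inl (.inl 1)))
    (u (.inl (.inr 0)) / u (.inl (.inr 1))) (u (.inl (.inr 1)))
    (u (.inr (.inl 0)) / u (.inr (.inl 1))) (u (.inr (.inl 1)))
    (u (.inr (.inr (.inl 0))) / u (.inr (.inr (.inl 1)))) (u (.inr (.inr (.inl 1))))
    (u (.inr (.inr (.inr 0))) / u (.inr (.inr (.inr 1)))) (u (.inr (.inr (.inr 1)))))⟩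
  rw [div_mul_cancel₀ _ hw, div_mul_cancel₀ _ hx, div_mul_cancel₀ _ hy, div_mul_cancel₀ _ hz,
    div_mul_cancel₀ _ (mul_ne_zero hv (pow_ne_zero 2 hw))]
  exact eq_coxVec u

/-- The kernel relations are solved by a_ij = ±l_j b_ij and a_ji = ±l_i b_ij for i < j. The quadrics
then turn the three non-monomial factors s, t, L into monomials in l and b, after which only
exponents need comparing. -/
theorem phiVal_psiVal_of_ker {l₀ l₁ l₂ l₃ b₀₁ b₀₂ b₀₃ b₁₂ b₁₃ b₂₃ : F} (hl₀ : l₀ ≠ 0)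
    (hl₁ : l₁ ≠ 0) (hl₂ : l₂ ≠ 0) (hl₃ : l₃ ≠ 0) (h₀₁ : b₀₁ ≠ 0) (h₀₂ : b₀₂ ≠ 0) (h₀₃ : b₀₃ ≠ 0)
    (h₁₂ : b₁₂ ≠ 0) (h₁₃ : b₁₃ ≠ 0) (h₂₃ : b₂₃ ≠ 0)
    (q₀ : l₂ * l₃ * b₁₂ * b₁₃ + l₁ * l₃ * b₁₂ * b₂₃ + l₁ * l₂ * b₁₃ * b₂₃ = 0)
    (q₁ : l₂ * l₃ * b₀₂ * b₀₃ - l₀ * l₂ * b₀₃ * b₂₃ - l₀ * l₃ * b₀₂ * b₂₃ = 0)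
    (q₂ : -(l₀ * l₃ * b₀₁ * b₁₃) - l₁ * l₃ * b₀₁ * b₀₃ + l₀ * l₁ * b₀₃ * b₁₃ = 0)
    (q₃ : l₁ * l₂ * b₀₁ * b₀₂ + l₀ * l₂ * b₀₁ * b₁₂ + l₀ * l₁ * b₀₂ * b₁₂ = 0)
    (a : Fin 12 → F) (ha : a = ![-(l₂ * b₂₃), -(l₁ * b₁₃), -(l₀ * b₀₃), l₃ * b₂₃, -(l₁ * b₁₂),
      -(l₀ * b₀₂), l₃ * b₁₃, l₂ * b₁₂, -(l₀ * b₀₁), l₃ * b₀₃, l₂ * b₀₂, l₁ * b₀₁]) :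
    ∃ c : F, c ≠ 0 ∧ phiVal (psiVal a) = c • a := by
  have hs : a 0 * a 6 ^ 2 + a 1 * a 3 ^ 2 = l₁ * l₂ * l₃ * b₁₃ ^ 2 * b₂₃ ^ 2 / b₁₂ := by
    simp [ha]
    field_simp
    linear_combination -q₀
  -- After division the quadrics say that the bivector with entries 1/b_ij, with signs changed at 02
  -- and 13, has zero wedge product with the vector (1/l_i). It is thus decomposable, and `pf` is
  -- its Plücker relation with denominators cleared.
  have pf : b₀₂ * b₀₃ * b₁₂ * b₁₃ - b₀₁ * b₀₃ * b₁₂ * b₂₃ + b₀₁ * b₀₂ * b₁₃ * b₂₃ = 0 := by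
    have : l₁ * l₂ * l₃ ≠ 0 := by positivity
    refine (mul_eq_zero.1 (?_ : (l₁ * l₂ * l₃) * _ = 0)).resolve_left this
    linear_combination (l₁ * b₁₂ * b₁₃) * q₁ + (l₂ * b₁₂ * b₂₃) * q₂ + (l₃ * b₁₃ * b₂₃) * q₃
  have ht : a 11 * a 0 + -(a 10 * a 1) = -(l₁ * l₂ * b₀₁ * b₂₃ * b₀₂ * b₁₃ / (b₁₂ * b₀₃)) := by
    simp [ha]
    field_simp
    linear_combination pf
  have hL : a 0 * a 6 ^ 2 * (a 11 * a 0) - a 1 * a 3 ^ 2 * -(a 10 * a 1) =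
      -(l₁ ^ 2 * l₂ ^ 2 * l₃ ^ 2 * b₁₃ ^ 2 * b₂₃ ^ 2 * b₀₁ * b₀₂ / (l₀ * b₁₂)) := by
    simp [ha]
    field_simp
    linear_combination q₃
  have key : phiVal (psiVal a) = phiMonomials (-(a 3 * a 10 * a 1 * a 11 * a 0)) (a 9)
      (-(a 10 * a 1)) (a 11 * a 0) (a 1 * a 3 ^ 2) (a 0 * a 6 ^ 2) (a 1) (-a 4) (a 6) (a 3)
      (a 0 * a 6 ^ 2 * (a 11 * a 0) - a 1 * a 3 ^ 2 * -(a 10 * a 1))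
      (a 0 * a 6 ^ 2 + a 1 * a 3 ^ 2) (a 11 * a 0 + -(a 10 * a 1)) := rfl
  rw [key, hs, ht, hL]
  -- The scalar is read off from the coordinate a₂₃.
  refine ⟨-(a 3 * (a 10 * a 1) ^ 2 * (a 11 * a 0) ^ 2 *
    -(l₁ ^ 2 * l₂ ^ 2 * l₃ ^ 2 * b₁₃ ^ 2 * b₂₃ ^ 2 * b₀₁ * b₀₂ / (l₀ * b₁₂)) *
    (a 1 * a 3 ^ 2) * (a 0 * a 6 ^ 2) * (a 1) ^ 2 * (a 3) ^ 2), ?_, ?_⟩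
  · simp [*]
  · subst ha
    ext i
    fin_cases i <;> simp [phiMonomials] <;> field_simp

/-- On configurations without vanishing entries, `psiVal` is a right inverse of `phiVal` up to a
scalar. -/
theorem IsConfig.phiVal_psiVal {a : Fin 12 → F} {l : Fin 4 → F} (h : IsConfig (signedMatrix a) l)
    (hl : l ≠ 0) (ha : ∀ i, a i ≠ 0) : ∃ c : F, c ≠ 0 ∧ phiVal (psiVal a) = c • a := by
  have k01 := h.ker 0 1 (by decide)
  have k02 := h.ker 0 2 (by decide)
  have k03 := h.ker 0 3 (by decide)
  have k12 := h.ker 1 2 (by decide)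
  have k13 := h.ker 1 3 (by decide)
  have k23 := h.ker 2 3 (by decide)
  have q3 := h.quad 0 1 2 (by decide) (by decide) (by decide)
  have q2 := h.quad 0 1 3 (by decide) (by decide) (by decide)
  have q1 := h.quad 0 2 3 (by decide) (by decide) (by decide)
  have q0 := h.quad 1 2 3 (by decide) (by decide) (by decide)
  simp [signedMatrix] at k01 k02 k03 k12 k13 k23 q0 q1 q2 q3
  have hl0 : l 0 ≠ 0 := by
    intro h0
    simp [h0, ha] at k01 k02 k03
    apply hl
    ext i
    fin_cases i <;> simp [*]
  have hl1 : l 1 ≠ 0 := fun h0 => by simp [h0, ha, hl0] at k01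
  have hl2 : l 2 ≠ 0 := fun h0 => by simp [h0, ha, hl0] at k02
  have hl3 : l 3 ≠ 0 := fun h0 => by simp [h0, ha, hl0] at k03
  have e8 : a 8 = -(l 0 * (a 11 / l 1)) := by field_simp; linear_combination k01
  have e5 : a 5 = -(l 0 * (a 10 / l 2)) := by field_simp; linear_combination -k02
  have e2 : a 2 = -(l 0 * (a 9 / l 3)) := by field_simp; linear_combination k03
  have e4 : a 4 = -(l 1 * (a 7 / l 2)) := by field_simp; linear_combination k12
  have e1 : a 1 = -(l 1 * (a 6 / l 3)) := by field_simp; linear_combination -k13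
  have e0 : a 0 = -(l 2 * (a 3 / l 3)) := by field_simp; linear_combination k23
  rw [e8, e5, e4] at q3
  rw [e8, e2, e1] at q2
  rw [e5, e2, e0] at q1
  rw [e4, e1, e0] at q0
  refine phiVal_psiVal_of_ker (b₀₁ := a 11 / l 1) (b₀₂ := a 10 / l 2) (b₀₃ := a 9 / l 3)
    (b₁₂ := a 7 / l 2) (b₁₃ := a 6 / l 3) (b₂₃ := a 3 / l 3) hl0 hl1 hl2 hl3 (div_ne_zero (ha _) hl1)
    (div_ne_zero (ha _) hl2) (div_ne_zero (ha _) hl3) (div_ne_zero (ha _) hl2)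
    (div_ne_zero (ha _) hl3) (div_ne_zero (ha _) hl3) ?_ ?_ ?_ ?_ a ?_
  · field_simp at q0 ⊢
    linear_combination -q0
  · field_simp at q1 ⊢
    linear_combination -q1
  · field_simp at q2 ⊢
    linear_combination -q2
  · field_simp at q3 ⊢
    linear_combination -q3
  · ext i
    fin_cases i <;> simp <;> first | assumption | field_simp

end Field

open MvPolynomial

/-! ### Transcendence degrees -/

theorem isAlgebraic_of_adjoin_eq_top {k E : Type*} [Field k] [Field E] [Algebra k E] {s : Set E}
    (h : IntermediateField.adjoin k s = ⊤) : Algebra.IsAlgebraic (Algebra.adjoin k s) E := by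
  refine ⟨fun x => ?_⟩
  have hx : x ∈ IntermediateField.adjoin k s := h ▸ IntermediateField.mem_top
  obtain ⟨r, hr, t, ht, rfl⟩ := IntermediateField.mem_adjoin_iff_div.1 hx
  have hr' : IsAlgebraic (Algebra.adjoin k s) r :=
    isAlgebraic_algebraMap (⟨r, hr⟩ : Algebra.adjoin k s)
  have ht' : IsAlgebraic (Algebra.adjoin k s) t :=
    isAlgebraic_algebraMap (⟨t, ht⟩ : Algebra.adjoin k s)
  rw [div_eq_mul_inv]
  exact hr'.mul ht'.inv

theorem aeval_mem_intermediateField {k E σ : Type*} [Field k] [Field E] [Algebra k E]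
    (L : IntermediateField k E) {x : σ → E} (hx : ∀ i, x i ∈ L) (f : MvPolynomial σ k) :
    aeval x f ∈ L := by
  induction f using MvPolynomial.induction_on with
  | C a => simp
  | add p q hp hq => simpa using add_mem hp hq
  | mul_X p i hp => simpa using mul_mem hp (hx i)

/-- A prime ideal of a polynomial ring has a generic point, whose coordinates generate the field
in which they lie. -/
theorem exists_genericPoint {k : Type u} [Field k] {σ : Type} (P : Ideal (MvPolynomial σ k))
    [P.IsPrime] : ∃ (F : Type u) (_ : Field F) (_ : Algebra k F) (x : σ → F),
      (∀ f, aeval x f = 0 ↔ f ∈ P) ∧ ∀ z : F, ∃ f g : MvPolynomial σ k, z = aeval x f / aeval x g := by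
  let A := MvPolynomial σ k ⧸ P
  let x : σ → FractionRing A := fun i => algebraMap A _ (Ideal.Quotient.mk P (X i))
  have hx : ∀ f, aeval x f = algebraMap A (FractionRing A) (Ideal.Quotient.mk P f) := by
    have : aeval x = (IsScalarTower.toAlgHom k A (FractionRing A)).comp
        (Ideal.Quotient.mkₐ k P) := by
      ext i
      simp [x, A]
    intro f
    rw [this]
    simp [A]
  refine ⟨FractionRing A, inferInstance, inferInstance, x, fun f => ?_, fun z => ?_⟩
  · rw [hx, FaithfulSMul.algebraMap_eq_zero_iff, Ideal.Quotient.eq_zero_iff_mem]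
  · obtain ⟨r, s, -, rfl⟩ := IsFractionRing.div_surjective (A := A) z
    obtain ⟨f, rfl⟩ := Ideal.Quotient.mk_surjective r
    obtain ⟨g, rfl⟩ := Ideal.Quotient.mk_surjective s
    exact ⟨f, g, by rw [hx, hx]⟩

/-- The quotient embeds into the field of the generic point, which is algebraic over the subalgebra
generated by the n elements. -/
theorem trdeg_quotient_le {k F : Type u} [Field k] [Field F] [Algebra k F] {σ : Type}
    {P : Ideal (MvPolynomial σ k)} {x : σ → F} (hx : ∀ f, aeval x f = 0 ↔ f ∈ P)
    (hgen : ∀ z : F, ∃ f g : MvPolynomial σ k, z = aeval x f / aeval x g) {n : ℕ}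
    (hn : ∃ g : Fin n → F, ∀ L : IntermediateField k F, (∀ m, g m ∈ L) → ∀ i, x i ∈ L) :
    Algebra.trdeg k (MvPolynomial σ k ⧸ P) ≤ n := by
  obtain ⟨g, h⟩ := hn
  have htop : IntermediateField.adjoin k (Set.range g) = ⊤ := by
    rw [eq_top_iff]
    intro z _
    have hL := h (IntermediateField.adjoin k (Set.range g))
      fun m => IntermediateField.subset_adjoin _ _ ⟨m, rfl⟩
    obtain ⟨p, q, rfl⟩ := hgen z
    exact div_mem (aeval_mem_intermediateField _ hL p) (aeval_mem_intermediateField _ hL q)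
  have := isAlgebraic_of_adjoin_eq_top htop
  let f : MvPolynomial σ k ⧸ P →ₐ[k] F := Ideal.Quotient.liftₐ P (aeval x) fun p hp => (hx p).2 hp
  have hf : Function.Injective f := by
    rw [injective_iff_map_eq_zero]
    intro r hr
    obtain ⟨p, rfl⟩ := Ideal.Quotient.mk_surjective r
    exact Ideal.Quotient.eq_zero_iff_mem.2 ((hx p).1 hr)
  calc Algebra.trdeg k (MvPolynomial σ k ⧸ P)
      ≤ Algebra.trdeg k F := trdeg_le_of_injective f hf
    _ ≤ Cardinal.mk (Set.range g) := Algebra.IsAlgebraic.trdeg_le_cardinalMk k _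
    _ ≤ n := by
      have := Cardinal.mk_range_le_lift (f := g)
      simpa using this

/-! ### Points satisfying the equations -/

section Points

variable {k : Type u} [Field k] {F : Type v} [Field F] [Algebra k F]

/-- Each column of the `a`-matrix belongs to a pair i < j and has only the entries a_ij and a_ji, so
a left kernel vector amounts to six two-term relations. -/
theorem exists_isConfig (x : Fin 12 → F)
    (h : ∀ f ∈ idealMinors k ⊔ idealQ k, aeval x f = 0) :
    ∃ l : Fin 4 → F, l ≠ 0 ∧ IsConfig (signedMatrix x) l := by
  have hm : ∀ c : Fin 4 → Fin 6,
      (((aMatrix k).map (aeval x)).submatrix id c).det = 0 := by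
    intro c
    have h1 := h _ (Ideal.mem_sup_left (Ideal.subset_span (Set.mem_range_self c)))
    rw [AlgHom.map_det] at h1
    exact h1
  obtain ⟨l, hl, hker⟩ := exists_vecMul_eq_zero_of_minors _ hm
  refine ⟨l, hl, ?_, ?_⟩
  · have hq : ∀ f ∈ ({ a12 k * a13 k - a21 k * a23 k + a31 k * a32 k,
        a02 k * a03 k - a30 k * a32 k + a20 k * a23 k,
        a10 k * a13 k - a01 k * a03 k + a30 k * a31 k,
        a01 k * a02 k - a10 k * a12 k + a20 k * a21 k } : Set (Sa k)), aeval x f = 0 :=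
      fun f hf => h f (Ideal.mem_sup_right (Ideal.subset_span hf))
    simp only [Set.mem_insert_iff, Set.mem_singleton_iff, forall_eq_or_imp, forall_eq] at hq
    obtain ⟨q0, q1, q2, q3⟩ := hq
    simp only [a01, a02, a03, a10, a12, a13, a20, a21, a23, a30, a31, a32, map_add, map_sub,
      map_mul, aeval_X] at q0 q1 q2 q3
    intro i j m hij him hjm
    fin_cases i <;> fin_cases j <;> fin_cases m <;>
      first
      | exact absurd rfl hij
      | exact absurd rfl him
      | exact absurd rfl hjm
      | (simp [signedMatrix]
         first
         | linear_combination -q0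
         | linear_combination -q1
         | linear_combination -q2
         | linear_combination -q3)
  · have h0 := hker 0
    have h1 := hker 1
    have h2 := hker 2
    have h3 := hker 3
    have h4 := hker 4
    have h5 := hker 5
    simp [Fin.sum_univ_four, aMatrix, a01, a02, a03, a10, a12, a13, a20, a21, a23, a30, a31,
      a32] at h0 h1 h2 h3 h4 h5
    intro i j hij
    fin_cases i <;> fin_cases j <;> first
      | exact absurd rfl hij
      | (simp [signedMatrix]
         first
         | linear_combination h0
         | linear_combination -h1
         | linear_combination h2
         | linear_combination h3
         | linear_combination -h4
         | linear_combination h5)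

theorem GeneratedBy.exists_generators {x : Fin 12 → F} {n : ℕ}
    (h : GeneratedBy k n (signedMatrix x)) :
    ∃ g : Fin n → F, ∀ L : IntermediateField k F, (∀ m, g m ∈ L) → ∀ i, x i ∈ L := by
  obtain ⟨g, hg⟩ := h
  refine ⟨g, fun L hL => ?_⟩
  have H := hg L hL
  have e0 : x 0 ∈ L := H 3 2 (by decide)
  have e1 : x 1 ∈ L := by simpa [signedMatrix] using H 3 1 (by decide)
  have e2 : x 2 ∈ L := H 3 0 (by decide)
  have e3 : x 3 ∈ L := H 2 3 (by decide)
  have e4 : x 4 ∈ L := H 2 1 (by decide)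
  have e5 : x 5 ∈ L := by simpa [signedMatrix] using H 2 0 (by decide)
  have e6 : x 6 ∈ L := by simpa [signedMatrix] using H 1 3 (by decide)
  have e7 : x 7 ∈ L := H 1 2 (by decide)
  have e8 : x 8 ∈ L := H 1 0 (by decide)
  have e9 : x 9 ∈ L := H 0 3 (by decide)
  have e10 : x 10 ∈ L := by simpa [signedMatrix] using H 0 2 (by decide)
  have e11 : x 11 ∈ L := H 0 1 (by decide)
  intro i
  fin_cases i <;> assumption

theorem exists_signedMatrix_eq_zero {x : Fin 12 → F} {i : Fin 12} (h : x i = 0) :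
    ∃ p q, p ≠ q ∧ signedMatrix x p q = 0 := by
  have key : ∀ i : Fin 12, ∃ p q, p ≠ q ∧ (signedMatrix x p q = x i ∨ signedMatrix x p q = -x i) :=
    by
    intro i
    fin_cases i
    exacts [⟨3, 2, by decide, .inl rfl⟩, ⟨3, 1, by decide, .inr rfl⟩, ⟨3, 0, by decide, .inl rfl⟩,
      ⟨2, 3, by decide, .inl rfl⟩, ⟨2, 1, by decide, .inl rfl⟩, ⟨2, 0, by decide, .inr rfl⟩,
      ⟨1, 3, by decide, .inr rfl⟩, ⟨1, 2, by decide, .inl rfl⟩, ⟨1, 0, by decide, .inl rfl⟩,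
      ⟨0, 3, by decide, .inl rfl⟩, ⟨0, 2, by decide, .inr rfl⟩, ⟨0, 1, by decide, .inl rfl⟩]
  obtain ⟨p, q, hpq, h1 | h1⟩ := key i <;> exact ⟨p, q, hpq, by simp [h1, h]⟩

theorem aeval_phiVal (u : CoxIndex → F) (f : Sa k) :
    aeval (phiVal u) f = aeval u (aeval (phi k) f) := by
  have : aeval (phiVal u) = (aeval u).comp (aeval (R := k) (phi k)) := by
    ext i
    simp [aeval_phi]
  rw [this]
  rfl

theorem exists_phiVal_psiVal {x : Fin 12 → F}
    (h : ∀ f ∈ idealMinors k ⊔ idealQ k, aeval x f = 0) (hx : ∀ i, x i ≠ 0) :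
    ∃ c : F, c ≠ 0 ∧ phiVal (psiVal x) = c • x := by
  obtain ⟨l, hl, hc⟩ := exists_isConfig x h
  exact hc.phiVal_psiVal hl hx

theorem exists_phiVal_eq {x : Fin 12 → F}
    (h : ∀ f ∈ idealMinors k ⊔ idealQ k, aeval x f = 0) (hx : ∀ i, x i ≠ 0) :
    ∃ u, phiVal u = x := by
  obtain ⟨c, hc, he⟩ := exists_phiVal_psiVal h hx
  refine ⟨scaleVec c⁻¹ (psiVal x), ?_⟩
  rw [phiVal_scaleVec (inv_ne_zero hc), he, smul_smul, inv_mul_cancel₀ hc, one_smul]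

/-- The six generators are five affine coordinates on the source of φ and one scalar for the cone.
-/
theorem exists_generators_of_ne_zero {x : Fin 12 → F}
    (h : ∀ f ∈ idealMinors k ⊔ idealQ k, aeval x f = 0) (hx : ∀ i, x i ≠ 0) :
    ∃ g : Fin 6 → F, ∀ L : IntermediateField k F, (∀ m, g m ∈ L) → ∀ i, x i ∈ L := by
  obtain ⟨c, hc, he⟩ := exists_phiVal_psiVal h hx
  obtain ⟨d, v, w, p, y, z, hd⟩ := phiVal_dehomogenize (psiVal x) (by simp [psiVal, coxVec, hx])
    (by simp [psiVal, coxVec, hx]) (by simp [psiVal, coxVec, hx]) (by simp [psiVal, coxVec, hx])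
    (by simp [psiVal, coxVec, hx])
  refine ⟨![c⁻¹ * d, v, w, p, y, z], fun L hL i => ?_⟩
  have hx' : x i = c⁻¹ * d * phiVal (coxVec v 1 w 1 p 1 y 1 z 1) i := by
    have := congrFun (he.symm.trans hd) i
    simp only [Pi.smul_apply, smul_eq_mul] at this
    field_simp
    linear_combination this
  rw [hx', ← aeval_phi (k := k)]
  refine mul_mem (hL 0) ?_
  refine aeval_mem_intermediateField L (forall_coxIndex.2 ?_) _
  exact ⟨⟨hL 1, one_mem L⟩, ⟨hL 2, one_mem L⟩, ⟨hL 3, one_mem L⟩, ⟨hL 4, one_mem L⟩,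
    ⟨hL 5, one_mem L⟩⟩

end Points

/-! ### The ideal of the image of `φ` -/

section HypIdeal

variable (k : Type u) [Field k]

/-- The ideal of all relations between the forms `phi`. -/
noncomputable def hypIdeal : Ideal (Sa k) :=
  RingHom.ker (aeval (R := k) (phi k)).toRingHom

theorem mem_hypIdeal {f : Sa k} : f ∈ hypIdeal k ↔ aeval (phi k) f = 0 := Iff.rfl

instance : (hypIdeal k).IsPrime := RingHom.ker_isPrime _

theorem phi_eq_phiVal (i : Fin 12) : phi k i = phiVal X i := by
  rw [← aeval_phi (k := k), aeval_X_left_apply]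

/-- A sample point off all twelve divisors: x₁ = 2 gives L = 1, s = 3, t = 2, whereas the all-ones
vector would give L = 0. -/
theorem phiVal_one_two_ne_zero {R : Type*} [CommRing R] [CharZero R] (i : Fin 12) :
    phiVal (coxVec (1 : R) 1 1 1 1 2 1 1 1 1) i ≠ 0 := by
  fin_cases i <;> simp [phiVal, phiMonomials, coxVec] <;> norm_num

theorem phi_ne_zero [CharZero k] (i : Fin 12) : phi k i ≠ 0 := by
  intro h
  have h1 := aeval_phi (k := k) (coxVec (1 : k) 1 1 1 1 2 1 1 1 1) i
  rw [h, map_zero] at h1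
  exact phiVal_one_two_ne_zero i h1.symm

theorem X_notMem_hypIdeal [CharZero k] (i : Fin 12) : X i ∉ hypIdeal k := by
  rw [mem_hypIdeal, aeval_X]
  exact phi_ne_zero k i

theorem sup_le_hypIdeal [CharZero k] : idealMinors k ⊔ idealQ k ≤ hypIdeal k := by
  refine sup_le (Ideal.span_le.2 ?_) (Ideal.span_le.2 ?_)
  · rintro _ ⟨c, rfl⟩
    simp only [SetLike.mem_coe, mem_hypIdeal]
    rw [AlgHom.map_det, ← Matrix.exists_vecMul_eq_zero_iff]
    -- This kernel vector comes from the ratios l_i/l_j = -a_ji/a_ij with denominators cleared.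
    set l : Fin 4 → CoxRing k :=
      ![v1 k * w0 k * w1 k * (w1 k + w0 k) * x0 k * x1 k * z1 k * (x1 k + x0 k) * y1 k,
        -(v0 k * (x1 k * w1 k - x0 k * w0 k) * z0 k * x0 k * (x1 k + x0 k) * y1 k),
        -(v0 k * (x1 k * w1 k - x0 k * w0 k) * x1 k * z1 k * (x1 k + x0 k) * y1 k),
        -(v0 k * (x1 k * w1 k - x0 k * w0 k) * y0 k * x0 k * x1 k * z1 k)] with hl
    have hker : ∀ j : Fin 6, ∑ i, l i * aeval (phi k) (aMatrix k i j) = 0 := by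
      intro j
      fin_cases j <;>
        simp [Fin.sum_univ_four, hl, aMatrix, a01, a02, a03, a10, a12, a13, a20, a21, a23, a30,
          a31, a32, phi] <;> ring
    refine ⟨l, fun h0 => ?_, ?_⟩
    · have h1 := congrArg (eval fun _ => (1 : k)) (congrFun h0 0)
      simp [hl, v1, w0, w1, x0, x1, z1, y1] at h1
    · funext j
      exact hker (c j)
  · intro f hf
    simp only [Set.mem_insert_iff, Set.mem_singleton_iff] at hf
    rcases hf with rfl | rfl | rfl | rfl <;>
      simp [mem_hypIdeal, a01, a02, a03, a10, a12, a13, a20, a21, a23, a30, a31, a32, phi] <;> ring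

variable {k}

/-- The generic point of P has nonzero coordinates, hence is a value of φ over its own field, and
every relation between the forms vanishes there. -/
theorem hypIdeal_le_of_forall_notMem {P : Ideal (Sa k)} [P.IsPrime]
    (hP : idealMinors k ⊔ idealQ k ≤ P) (hX : ∀ i, X i ∉ P) : hypIdeal k ≤ P := by
  obtain ⟨F, _, _, x, hx, -⟩ := exists_genericPoint P
  obtain ⟨u, hu⟩ := exists_phiVal_eq (k := k) (fun f hf => (hx f).2 (hP hf))
    fun i h => hX i ((hx _).1 (by rwa [aeval_X]))
  intro f hf
  rw [← hx, ← hu, aeval_phiVal, (mem_hypIdeal k).1 hf, map_zero]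

theorem trdeg_le_five_of_X_mem {P : Ideal (Sa k)} [P.IsPrime]
    (hP : idealMinors k ⊔ idealQ k ≤ P) {i : Fin 12} (hX : X i ∈ P) :
    Algebra.trdeg k (Sa k ⧸ P) ≤ 5 := by
  obtain ⟨F, _, _, x, hx, hgen⟩ := exists_genericPoint P
  obtain ⟨l, hl, hc⟩ := exists_isConfig (k := k) _ (fun f hf => (hx f).2 (hP hf))
  have hxi : x i = 0 := by simpa using (hx (X i)).2 hX
  obtain ⟨p, q, hpq, h0⟩ := exists_signedMatrix_eq_zero hxi
  exact_mod_cast trdeg_quotient_le hx hgen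
    (generatedBy_of_eq_zero (k := k) hc hl hpq h0).exists_generators

theorem trdeg_hypIdeal_le [CharZero k] : Algebra.trdeg k (Sa k ⧸ hypIdeal k) ≤ 6 := by
  obtain ⟨F, _, _, x, hx, hgen⟩ := exists_genericPoint (hypIdeal k)
  exact_mod_cast trdeg_quotient_le hx hgen
    (exists_generators_of_ne_zero (fun f hf => (hx f).2 (sup_le_hypIdeal k hf))
      fun i h => X_notMem_hypIdeal k i ((hx _).1 (by rwa [aeval_X])))

/-- The parameters are rational functions of the values of the parametrisation. -/
theorem mem_of_phiVal_mem {F : Type*} [Field F] [Algebra k F] {c v w x y z : F} (hc : c ≠ 0)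
    (hv : v ≠ 0) (hw : w ≠ 0) (hx : x ≠ 0) (hy : y ≠ 0) (hz : z ≠ 0) (hs : 1 + x ≠ 0)
    (ht : 1 + w ≠ 0) (hL : 1 - x * w ≠ 0) (L : IntermediateField k F)
    (h : ∀ i, c * phiVal (coxVec v 1 w 1 x 1 y 1 z 1) i ∈ L) :
    c ∈ L ∧ v ∈ L ∧ w ∈ L ∧ x ∈ L ∧ y ∈ L ∧ z ∈ L := by
  have h0 := h 0
  have h1 := h 1
  have h3 := h 3
  have h4 := h 4
  have h6 := h 6
  have h9 := h 9
  have h10 := h 10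
  have h11 := h 11
  simp [phiVal, phiMonomials, coxVec] at h0 h1 h3 h4 h6 h9 h10 h11
  have hL' : 1 - w * x ≠ 0 := by rwa [mul_comm]
  have mz : z ∈ L := by
    convert div_mem h6 h3 using 1
    field_simp
  have my : y ∈ L := by
    convert div_mem h1 h4 using 1
    field_simp
  have mx : x ∈ L := by
    convert div_mem h1 (mul_mem h0 (pow_mem mz 2)) using 1
    field_simp
  have mw : w ∈ L := by
    convert div_mem (mul_mem h10 h1) (mul_mem h11 h0) using 1
    field_simp
  have mv : v ∈ L := by
    convert mul_mem (div_mem h3 h9) mw using 1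
    field_simp
  refine ⟨?_, mv, mw, mx, my, mz⟩
  have hd : v ^ 2 * (1 - x * w) * x * y ^ 2 ∈ L :=
    mul_mem (mul_mem (mul_mem (pow_mem mv 2) (sub_mem (one_mem L) (mul_mem mx mw))) mx)
      (pow_mem my 2)
  convert div_mem h3 hd using 1
  field_simp

/-- Evaluating the scaled parametrisation at six independent parameters maps the quotient to a
rational function field, and by `mem_of_phiVal_mem` the image generates that field. -/
theorem le_trdeg_hypIdeal [CharZero k] : 6 ≤ Algebra.trdeg k (Sa k ⧸ hypIdeal k) := by
  obtain ⟨E, _, _, p, hpX, hgen⟩ := exists_genericPoint (⊥ : Ideal (MvPolynomial (Fin 6) k))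
  -- A polynomial that is nonzero at (2, …, 2) is nonzero at the generic point; the value 2 also
  -- keeps 1 - xw away from zero.
  have hne : ∀ f : MvPolynomial (Fin 6) k, eval (fun _ => (2 : k)) f ≠ 0 → aeval p f ≠ 0 := by
    intro f hf h0
    rw [hpX, Ideal.mem_bot] at h0
    simp [h0] at hf
  have hp : ∀ i, p i ≠ 0 := fun i => by simpa using hne (X i) (by simp)
  have hs : 1 + p 3 ≠ 0 := by
    have := hne (1 + X 3) (by simp; norm_num)
    rwa [map_add, map_one, aeval_X] at this
  have ht : 1 + p 2 ≠ 0 := by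
    have := hne (1 + X 2) (by simp; norm_num)
    rwa [map_add, map_one, aeval_X] at this
  have hL : 1 - p 3 * p 2 ≠ 0 := by
    have := hne (1 - X 3 * X 2) (by simp; norm_num)
    rwa [map_sub, map_mul, map_one, aeval_X, aeval_X] at this
  set u := coxVec (p 1) 1 (p 2) 1 (p 3) 1 (p 4) 1 (p 5) 1 with hu
  let f : Sa k →ₐ[k] E := aeval (phiVal (scaleVec (p 0) u))
  let fbar : Sa k ⧸ hypIdeal k →ₐ[k] E := Ideal.Quotient.liftₐ (hypIdeal k) f fun g hg => by
    simp only [f]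
    rw [aeval_phiVal, (mem_hypIdeal k).1 hg, map_zero]
  have hadj : IntermediateField.adjoin k (fbar.range : Set E) = ⊤ := by
    rw [eq_top_iff]
    intro x _
    set L := IntermediateField.adjoin k (fbar.range : Set E) with hLdef
    have hmem : ∀ i, p 0 * phiVal u i ∈ L := by
      intro i
      refine IntermediateField.subset_adjoin _ _ ⟨Ideal.Quotient.mk _ (X i), ?_⟩
      change f (X i) = _
      simp only [f, aeval_X]
      rw [phiVal_scaleVec (hp 0)]
      rfl
    obtain ⟨m0, m1, m2, m3, m4, m5⟩ := mem_of_phiVal_mem (hp 0) (hp 1) (hp 2) (hp 3) (hp 4) (hp 5)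
      hs ht hL L hmem
    have hpL : ∀ i, p i ∈ L := by
      intro i
      fin_cases i <;> assumption
    obtain ⟨r, s, rfl⟩ := hgen x
    exact div_mem (aeval_mem_intermediateField _ hpL r) (aeval_mem_intermediateField _ hpL s)
  have halg := isAlgebraic_of_adjoin_eq_top hadj
  rw [Algebra.adjoin_eq] at halg
  have hE : (6 : Cardinal) ≤ Algebra.trdeg k E := by
    have hX : AlgebraicIndependent k p := by
      rw [AlgebraicIndependent, injective_iff_map_eq_zero]
      exact fun f hf => by simpa using (hpX f).1 hf
    have := hX.lift_cardinalMk_le_trdeg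
    simpa using this
  calc (6 : Cardinal) ≤ Algebra.trdeg k E := hE
    _ = Algebra.trdeg k fbar.range := by
      rw [← trdeg_add_eq k fbar.range (A := E), trdeg_eq_zero (R := fbar.range), add_zero]
    _ ≤ Algebra.trdeg k (Sa k ⧸ hypIdeal k) :=
      trdeg_le_of_surjective fbar.rangeRestrict fbar.rangeRestrict_surjective

/-- The ideal of relations between the forms `phi` is the only ideal `J_hyp`. -/
theorem isHypIdeal_iff [CharZero k] {J : Ideal (Sa k)} : IsHypIdeal k J ↔ J = hypIdeal k := by
  constructor
  · rintro ⟨hmin, htr⟩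
    have hprime : J.IsPrime := hmin.1.1
    -- Minimality reduces both inclusions to `hypIdeal` ≤ J, and J contains no variable because 6 >
    -- 5.
    refine le_antisymm (hmin.2 ⟨inferInstance, sup_le_hypIdeal k⟩ ?_) ?_ <;>
    · refine hypIdeal_le_of_forall_notMem hmin.1.2 fun i hi => ?_
      have h5 := trdeg_le_five_of_X_mem hmin.1.2 hi
      rw [htr] at h5
      norm_num at h5
  · rintro rfl
    refine ⟨⟨⟨inferInstance, sup_le_hypIdeal k⟩, fun P hP hle => ?_⟩, ?_⟩
    · have := hP.1
      exact hypIdeal_le_of_forall_notMem hP.2 fun i hi => X_notMem_hypIdeal k i (hle hi)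
    · rw [show (5 + 1 : Cardinal) = 6 by norm_num]
      exact le_antisymm trdeg_hypIdeal_le le_trdeg_hypIdeal

end HypIdeal

end HypLocus

namespace CoxData

open MvPolynomial

/-! ### Homogeneous forms and the torus action -/

section Torus

variable {σ ρ σ' ρ' : Type} {T : CoxData σ ρ} {T' : CoxData σ' ρ'} {k : Type u} [Field k]

theorem isHomog_X (s : σ) : T.IsHomog (X s : MvPolynomial σ k) (T.weight s) :=
  isWeightedHomogeneous_X k T.weight s

theorem IsHomog.prod {ι : Type*} [Fintype ι] {f : ι → MvPolynomial σ k} {d : ι → ρ → ℕ}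
    (hf : ∀ i, T.IsHomog (f i) (d i)) : T.IsHomog (∏ i, f i) (∑ i, d i) :=
  IsWeightedHomogeneous.prod _ _ _ fun i _ => hf i

variable [Fintype ρ] [Fintype ρ'] {K : Type v} [Field K] [Algebra k K]

theorem IsHomog.aeval_smul {f : MvPolynomial σ k} {d : ρ → ℕ} (hf : T.IsHomog f d) (t : ρ → K)
    (x : σ → K) :
    aeval (fun s => (∏ i, t i ^ T.weight s i) * x s) f = (∏ i, t i ^ d i) * aeval x f := by
  simp only [aeval_def, eval₂_eq, Finset.mul_sum]
  refine Finset.sum_congr rfl fun m hm => ?_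
  have hw : Finsupp.weight T.weight m = d := hf (mem_support_iff.1 hm)
  have hprod : ∏ s ∈ m.support, (∏ i, t i ^ T.weight s i) ^ m s = ∏ i, t i ^ d i := by
    simp only [← Finset.prod_pow, ← pow_mul]
    rw [Finset.prod_comm]
    refine Finset.prod_congr rfl fun i _ => ?_
    rw [Finset.prod_pow_eq_pow_sum, ← hw, Finsupp.weight_apply, Finsupp.sum, Finset.sum_apply]
    refine congrArg _ (Finset.sum_congr rfl fun s _ => ?_)
    simp [mul_comm]
  simp only [mul_pow, Finset.prod_mul_distrib, hprod]
  ring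

theorem exists_represents (p : T.Point K) : ∃ x, T.Represents x p := by
  obtain ⟨⟨x, hx⟩, rfl⟩ := Quotient.exists_rep p
  exact ⟨x, hx, rfl⟩

theorem Represents.exists_smul {x y : σ → K} {p : T.Point K} (hx : T.Represents x p)
    (hy : T.Represents y p) : ∃ t : ρ → Kˣ, y = fun s => (∏ i, (t i : K) ^ T.weight s i) * x s := by
  obtain ⟨hx', rfl⟩ := hx
  obtain ⟨hy', h⟩ := hy
  obtain ⟨t, ht⟩ := Quotient.exact h.symm
  exact ⟨t, funext ht⟩

theorem Represents.smul {x : σ → K} {p : T.Point K} (hx : T.Represents x p) (t : ρ → Kˣ) :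
    T.Represents (fun s => (∏ i, (t i : K) ^ T.weight s i) * x s) p := by
  obtain ⟨hx', rfl⟩ := hx
  have hy : T.IsCoord fun s => (∏ i, (t i : K) ^ T.weight s i) * x s := by
    intro i
    obtain ⟨s, hs, h0⟩ := hx' i
    exact ⟨s, hs, mul_ne_zero (Finset.prod_ne_zero_iff.2 fun j _ => by simp) h0⟩
  exact ⟨hy, (Quotient.sound ⟨t, fun s => rfl⟩ : Quotient.mk (T.setoid K) ⟨x, hx'⟩ = _).symm⟩

theorem Represents.unique {x : σ → K} {p q : T.Point K} (hp : T.Represents x p)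
    (hq : T.Represents x q) : p = q := by
  obtain ⟨_, rfl⟩ := hp
  obtain ⟨_, rfl⟩ := hq
  rfl

theorem Represents.aeval_ne_zero {x y : σ → K} {p : T.Point K} (hx : T.Represents x p)
    (hy : T.Represents y p) {f : MvPolynomial σ k} {d : ρ → ℕ} (hf : T.IsHomog f d)
    (h : aeval x f ≠ 0) : aeval y f ≠ 0 := by
  obtain ⟨t, rfl⟩ := hx.exists_smul hy
  rw [hf.aeval_smul]
  exact mul_ne_zero (Finset.prod_ne_zero_iff.2 fun j _ => by simp) h

/-- Compatible multidegrees carry the source torus action to the target torus action, so one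
representative of p is enough. -/
theorem IsFormTuple.mapsTo {Φ : σ' → MvPolynomial σ k} (hΦ : T.IsFormTuple T' Φ) {x : σ → K}
    {p : T.Point K} {q : T'.Point K} (hp : T.Represents x p)
    (hq : T'.Represents (fun s => aeval x (Φ s)) q) : T.MapsTo T' Φ p q := by
  obtain ⟨δ, hδ⟩ := hΦ
  intro y hy
  obtain ⟨t, rfl⟩ := hp.exists_smul hy
  have h := hq.smul fun j => ∏ i, t i ^ δ j i
  convert h using 2 with s
  rw [(hδ s).aeval_smul]
  congr 1
  simp only [Units.coe_prod, Units.val_pow_eq_pow_val, ← Finset.prod_pow, Finset.sum_apply,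
    Pi.smul_apply, smul_eq_mul, ← Finset.prod_pow_eq_pow_sum]
  rw [Finset.prod_comm]
  refine Finset.prod_congr rfl fun j _ => Finset.prod_congr rfl fun i _ => ?_
  rw [← pow_mul, mul_comm]

/-- The locus where a homogeneous form does not vanish. -/
def basicOpen (T : CoxData σ ρ) (K : Type v) [Field K] [Algebra k K] (f : MvPolynomial σ k) :
    Set (T.Point K) :=
  {p | ∀ x, T.Represents x p → aeval x f ≠ 0}

theorem isZariskiOpen_basicOpen {f : MvPolynomial σ k} {d : ρ → ℕ} (hf : T.IsHomog f d) :
    T.IsZariskiOpen k (T.basicOpen K f) :=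
  ⟨{f}, by simpa using ⟨d, hf⟩, by simp [basicOpen]⟩

theorem Represents.mem_basicOpen {x : σ → K} {p : T.Point K} (hx : T.Represents x p)
    {f : MvPolynomial σ k} {d : ρ → ℕ} (hf : T.IsHomog f d) (h : aeval x f ≠ 0) :
    p ∈ T.basicOpen K f :=
  fun _ hy => hx.aeval_ne_zero hy hf h

end Torus

end CoxData

namespace HypLocus

open MvPolynomial CoxData

/-! ### Homogeneity of the forms -/

section Homogeneity

theorem _root_.MvPolynomial.IsWeightedHomogeneous.of_eq {σ R M : Type*} [CommSemiring R]
    [AddCommMonoid M] {w : σ → M} {p : MvPolynomial σ R} {m n : M}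
    (h : IsWeightedHomogeneous w p m) (e : m = n) : IsWeightedHomogeneous w p n := e ▸ h

/-- With L, s, t treated as symbols of known degree, each form is a monomial up to sign. The grading
is arbitrary so that the count serves both the Cox ring and ℙ⁹. -/
theorem isWeightedHomogeneous_phiMonomials {σ R M : Type*} [CommRing R] [AddCommMonoid M]
    {w : σ → M} {v₀ v₁ w₀ w₁ x₀ x₁ y₀ y₁ z₀ z₁ L s t : MvPolynomial σ R} {α β ξ η ζ : M}
    (hv₀ : IsWeightedHomogeneous w v₀ (α + 2 • β)) (hv₁ : IsWeightedHomogeneous w v₁ α)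
    (hw₀ : IsWeightedHomogeneous w w₀ β) (hw₁ : IsWeightedHomogeneous w w₁ β)
    (hx₀ : IsWeightedHomogeneous w x₀ ξ) (hx₁ : IsWeightedHomogeneous w x₁ ξ)
    (hy₀ : IsWeightedHomogeneous w y₀ η) (hy₁ : IsWeightedHomogeneous w y₁ η)
    (hz₀ : IsWeightedHomogeneous w z₀ ζ) (hz₁ : IsWeightedHomogeneous w z₁ ζ)
    (hL : IsWeightedHomogeneous w L (ξ + β)) (hs : IsWeightedHomogeneous w s ξ)
    (ht : IsWeightedHomogeneous w t β) (i : Fin 12) :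
    IsWeightedHomogeneous w (phiMonomials v₀ v₁ w₀ w₁ x₀ x₁ y₀ y₁ z₀ z₁ L s t i)
      (2 • α + 5 • β + 3 • ξ + 2 • η + 2 • ζ) := by
  fin_cases i
  · exact (((((((hv₀.pow 2).mul hL).mul hx₁).mul hs).mul hy₀).mul hy₁).mul
      (hz₁.pow 2)).of_eq (by abel)
  · exact (((((((hv₀.pow 2).mul hL).mul hx₀).mul hs).mul hy₀).mul hy₁).mul
      (hz₀.pow 2)).of_eq (by abel)
  · exact ((((((((((hv₁.pow 2).mul (hw₀.pow 2)).mul (hw₁.pow 2)).mul ht).mul hx₀).mul hx₁).mul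
      hs).mul hy₀).mul hy₁).mul (hz₁.pow 2)).neg.of_eq (by abel)
  · exact ((((((hv₀.pow 2).mul hL).mul hx₀).mul hx₁).mul (hy₀.pow 2)).mul
      (hz₁.pow 2)).neg.of_eq (by abel)
  · exact ((((((hv₀.pow 2).mul hL).mul hx₀).mul hs).mul (hy₁.pow 2)).mul
      (hz₀.pow 2)).neg.of_eq (by abel)
  · exact (((((((((hv₁.pow 2).mul (hw₀.pow 2)).mul hw₁).mul (ht.pow 2)).mul hx₀).mul hx₁).mul
      hs).mul (hy₁.pow 2)).mul (hz₁.pow 2)).of_eq (by abel)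
  · exact (((((((hv₀.pow 2).mul hL).mul hx₀).mul hx₁).mul (hy₀.pow 2)).mul hz₀).mul
      hz₁).neg.of_eq (by abel)
  · exact (((((((hv₀.pow 2).mul hL).mul hx₁).mul hs).mul (hy₁.pow 2)).mul hz₀).mul
      hz₁).of_eq (by abel)
  · exact ((((((((((hv₁.pow 2).mul hw₀).mul (hw₁.pow 2)).mul (ht.pow 2)).mul hx₀).mul hx₁).mul
      hs).mul (hy₁.pow 2)).mul hz₀).mul hz₁).neg.of_eq (by abel)
  · exact ((((((((hv₀.mul hv₁).mul hw₀).mul hw₁).mul hL).mul hx₀).mul hx₁).mul (hy₀.pow 2)).mul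
      (hz₁.pow 2)).neg.of_eq (by abel)
  · exact ((((((((hv₀.mul hv₁).mul hw₀).mul ht).mul hL).mul hx₁).mul hs).mul (hy₁.pow 2)).mul
      (hz₁.pow 2)).of_eq (by abel)
  · exact ((((((((hv₀.mul hv₁).mul hw₁).mul ht).mul hL).mul hx₀).mul hs).mul (hy₁.pow 2)).mul
      (hz₀.pow 2)).neg.of_eq (by abel)

theorem isWeightedHomogeneous_phiVal {σ R M : Type*} [CommRing R] [AddCommMonoid M]
    {w : σ → M} {u : CoxIndex → MvPolynomial σ R} {α β ξ η ζ : M}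
    (hv₀ : IsWeightedHomogeneous w (u (.inl (.inl 0))) (α + 2 • β))
    (hv₁ : IsWeightedHomogeneous w (u (.inl (.inl 1))) α)
    (hw₀ : IsWeightedHomogeneous w (u (.inl (.inr 0))) β)
    (hw₁ : IsWeightedHomogeneous w (u (.inl (.inr 1))) β)
    (hx₀ : IsWeightedHomogeneous w (u (.inr (.inl 0))) ξ)
    (hx₁ : IsWeightedHomogeneous w (u (.inr (.inl 1))) ξ)
    (hy₀ : IsWeightedHomogeneous w (u (.inr (.inr (.inl 0)))) η)
    (hy₁ : IsWeightedHomogeneous w (u (.inr (.inr (.inl 1)))) η)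
    (hz₀ : IsWeightedHomogeneous w (u (.inr (.inr (.inr 0)))) ζ)
    (hz₁ : IsWeightedHomogeneous w (u (.inr (.inr (.inr 1)))) ζ) (i : Fin 12) :
    IsWeightedHomogeneous w (phiVal u i) (2 • α + 5 • β + 3 • ξ + 2 • η + 2 • ζ) :=
  isWeightedHomogeneous_phiMonomials hv₀ hv₁ hw₀ hw₁ hx₀ hx₁ hy₀ hy₁ hz₀ hz₁
    ((hx₁.mul hw₁).sub (hx₀.mul hw₀)) (hx₁.add hx₀) (hw₁.add hw₀) i

variable (k : Type u) [Field k]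

theorem isHomog_phi : ∃ d, ∀ i, FxP1xP1xP1.IsHomog (phi k i) d := by
  have hX := isWeightedHomogeneous_X k FxP1xP1xP1.weight
  refine ⟨2 • FxP1xP1xP1.weight (.inl (.inl 1)) + 5 • FxP1xP1xP1.weight (.inl (.inr 0)) +
    3 • FxP1xP1xP1.weight (.inr (.inl 0)) + 2 • FxP1xP1xP1.weight (.inr (.inr (.inl 0))) +
    2 • FxP1xP1xP1.weight (.inr (.inr (.inr 0))), fun i => ?_⟩
  rw [phi_eq_phiVal]
  refine isWeightedHomogeneous_phiVal ((hX _).of_eq ?_) (hX _) (hX _) ((hX _).of_eq ?_) (hX _)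
    ((hX _).of_eq ?_) (hX _) ((hX _).of_eq ?_) (hX _) ((hX _).of_eq ?_) i <;> decide

theorem isFormTuple_phi : FxP1xP1xP1.IsFormTuple P11 (phi k) := by
  obtain ⟨d, hd⟩ := isHomog_phi k
  exact ⟨fun _ => d, fun i => by simpa [P11, proj] using hd i⟩

theorem isFormTuple_psi : P11.IsFormTuple FxP1xP1xP1 (psi k) := by
  have hX : ∀ i : Fin 12, IsWeightedHomogeneous P11.weight (X i : Sa k) 1 :=
    isWeightedHomogeneous_X k P11.weight
  -- The degrees of v₁, w, x, y, z under ψ; v₀ then has degree 1 + 2·2 = 5.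
  refine ⟨Sum.elim ![1, 2] (Sum.elim 3 (Sum.elim 1 1)), forall_coxIndex.2 ?_⟩
  refine ⟨⟨?_, ?_⟩, ⟨?_, ?_⟩, ⟨?_, ?_⟩, ⟨?_, ?_⟩, ⟨?_, ?_⟩⟩
  · exact (((((hX 3).mul (hX 10)).mul (hX 1)).mul (hX 11)).mul (hX 0)).neg.of_eq (by decide)
  · exact (hX 9).of_eq (by decide)
  · exact ((hX 10).mul (hX 1)).neg.of_eq (by decide)
  · exact ((hX 11).mul (hX 0)).of_eq (by decide)
  · exact ((hX 1).mul ((hX 3).pow 2)).of_eq (by decide)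
  · exact ((hX 0).mul ((hX 6).pow 2)).of_eq (by decide)
  · exact (hX 1).of_eq (by decide)
  · exact (hX 4).neg.of_eq (by decide)
  · exact (hX 6).of_eq (by decide)
  · exact (hX 3).of_eq (by decide)

end Homogeneity

/-! ### Birationality -/

section Birational

variable {k : Type u} [Field k] {K : Type v} [Field K] [Algebra k K]

theorem mem_variety_of_represents {u : CoxIndex → K} {q : P11.Point K}
    (h : P11.Represents (phiVal u) q) : q ∈ variety K (hypIdeal k) := by
  intro y hy f hf
  obtain ⟨t, rfl⟩ := h.exists_smul hy
  have : (fun s => (∏ i, (t i : K) ^ P11.weight s i) * phiVal u s) =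
      phiVal (scaleVec (t () : K) u) := by
    rw [phiVal_scaleVec (Units.ne_zero _)]
    ext s
    simp [P11, proj]
  rw [this, aeval_phiVal, (mem_hypIdeal k).1 hf, map_zero]

theorem exists_psiVal_phiVal {u : CoxIndex → K} (hu : ∀ i, phiVal u i ≠ 0) :
    ∃ t : Fin 2 ⊕ Unit ⊕ Unit ⊕ Unit → Kˣ,
      psiVal (phiVal u) = fun s => (∏ i, (t i : K) ^ FxP1xP1xP1.weight s i) * u s := by
  rw [eq_coxVec u] at hu ⊢
  generalize u (.inl (.inl 0)) = v₀, u (.inl (.inl 1)) = v₁, u (.inl (.inr 0)) = w₀,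
    u (.inl (.inr 1)) = w₁, u (.inr (.inl 0)) = x₀, u (.inr (.inl 1)) = x₁,
    u (.inr (.inr (.inl 0))) = y₀, u (.inr (.inr (.inl 1))) = y₁, u (.inr (.inr (.inr 0))) = z₀,
    u (.inr (.inr (.inr 1))) = z₁ at *
  -- The identity is one of monomials, so the definitions of L, s, t can be forgotten.
  obtain ⟨L, eL⟩ : ∃ L, L = x₁ * w₁ - x₀ * w₀ := ⟨_, rfl⟩
  obtain ⟨s, es⟩ : ∃ s, s = x₁ + x₀ := ⟨_, rfl⟩
  obtain ⟨t, et⟩ : ∃ t, t = w₁ + w₀ := ⟨_, rfl⟩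
  have key : phiVal (coxVec v₀ v₁ w₀ w₁ x₀ x₁ y₀ y₁ z₀ z₁) =
      phiMonomials v₀ v₁ w₀ w₁ x₀ x₁ y₀ y₁ z₀ z₁ L s t := by rw [eL, es, et]; rfl
  rw [key] at hu ⊢
  clear key eL es et
  have h1 := hu 1
  have h2 := hu 2
  simp [phiMonomials] at h1 h2
  obtain ⟨⟨⟨⟨⟨⟨hv₀, hL⟩, hx₀⟩, hs⟩, hy₀⟩, hy₁⟩, hz₀⟩ := h1
  obtain ⟨⟨⟨⟨⟨⟨⟨⟨⟨hv₁, hw₀⟩, hw₁⟩, ht⟩, -⟩, hx₁⟩, -⟩, -⟩, -⟩, hz₁⟩ := h2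
  -- These are the factors by which ψ(φ(u)) differs from u in v₁ and in the blocks w, x, y, z; v₀
  -- also picks up the square of the factor of w.
  have hv : -(v₀ * w₀ * w₁ * L * x₀ * x₁ * y₀ ^ 2 * z₁ ^ 2) ≠ 0 := by simp [*]
  have hw : -(v₀ ^ 3 * v₁ * t * L ^ 2 * x₀ * x₁ * s ^ 2 * y₀ * y₁ ^ 3 * z₀ ^ 2 * z₁ ^ 2) ≠ 0 := by
    simp [*]
  have hx : v₀ ^ 6 * L ^ 3 * s * y₀ ^ 5 * y₁ * z₀ ^ 2 * z₁ ^ 4 * x₀ ^ 2 * x₁ ^ 2 ≠ 0 := by simp [*]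
  have hy : v₀ ^ 2 * L * x₀ * s * y₁ * z₀ ^ 2 ≠ 0 := by simp [*]
  have hz : -(v₀ ^ 2 * L * x₀ * x₁ * y₀ ^ 2 * z₁) ≠ 0 := by simp [*]
  refine ⟨Sum.elim ![Units.mk0 _ hv, Units.mk0 _ hw] (Sum.elim (fun _ => Units.mk0 _ hx)
    (Sum.elim (fun _ => Units.mk0 _ hy) fun _ => Units.mk0 _ hz)), ?_⟩
  rw [funext_iff, forall_coxIndex]
  simp [psiVal, coxVec, phiMonomials, FxP1xP1xP1, CoxData.prod, hirzebruch, proj]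
  refine ⟨⟨?_, ?_⟩, ⟨?_, ?_⟩, ⟨?_, ?_⟩, ⟨?_, ?_⟩, ?_, ?_⟩ <;> ring

theorem isBirationalMap_phi [CharZero k] :
    FxP1xP1xP1.IsBirationalMap P11 (phi k) (variety K (hypIdeal k)) := by
  obtain ⟨d, hd⟩ := isHomog_phi k
  have hphi : FxP1xP1xP1.IsHomog (∏ i, phi k i) (∑ _i : Fin 12, d) := IsHomog.prod hd
  have hX : P11.IsHomog (∏ i, X i : Sa k) (∑ i, P11.weight i) := IsHomog.prod fun i => isHomog_X i
  have hphi0 : ∀ u : CoxIndex → K, aeval u (∏ i, phi k i) ≠ 0 ↔ ∀ i, phiVal u i ≠ 0 := fun u => by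
    simp only [map_prod, aeval_phi, Finset.prod_ne_zero_iff, Finset.mem_univ, true_imp_iff]
  have hX0 : ∀ a : Fin 12 → K, aeval a (∏ i, X i : Sa k) ≠ 0 ↔ ∀ i, a i ≠ 0 := fun a => by
    simp only [map_prod, aeval_X, Finset.prod_ne_zero_iff, Finset.mem_univ, true_imp_iff]
  set U := FxP1xP1xP1.basicOpen K (∏ i, phi k i)
  set O := P11.basicOpen K (∏ i, X i : Sa k)
  have haeval : ∀ u : CoxIndex → K, (fun s => aeval u (phi k s)) = phiVal u :=
    fun u => funext (aeval_phi u)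
  have coordP : ∀ a : Fin 12 → K, (∀ i, a i ≠ 0) → P11.IsCoord a := fun a ha i => ⟨0, rfl, ha 0⟩
  have coordF : ∀ a : Fin 12 → K, (∀ i, a i ≠ 0) → FxP1xP1xP1.IsCoord (psiVal a) := by
    rintro a ha (i | ⟨⟩ | ⟨⟩ | ⟨⟩)
    · fin_cases i
      · exact ⟨.inl (.inl 1), rfl, ha 9⟩
      · exact ⟨.inl (.inr 1), rfl, mul_ne_zero (ha 11) (ha 0)⟩
    · exact ⟨.inr (.inl 1), rfl, mul_ne_zero (ha 0) (pow_ne_zero 2 (ha 6))⟩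
    · exact ⟨.inr (.inr (.inl 0)), rfl, ha 1⟩
    · exact ⟨.inr (.inr (.inr 0)), rfl, ha 6⟩
  have hfwd : ∀ p : U, ∃ q : ↥(variety K (hypIdeal k) ∩ O),
      FxP1xP1xP1.MapsTo P11 (phi k) p.1 q.1 := by
    rintro ⟨p, hp⟩
    obtain ⟨u, hu⟩ := exists_represents p
    have hu0 := (hphi0 u).1 (hp u hu)
    have hq : P11.Represents (phiVal u) (Quotient.mk (P11.setoid K) ⟨_, coordP _ hu0⟩) := ⟨_, rfl⟩
    exact ⟨⟨_, mem_variety_of_represents hq, hq.mem_basicOpen hX ((hX0 _).2 hu0)⟩,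
      (isFormTuple_phi k).mapsTo hu (by rwa [haeval])⟩
  have hcomp : ∀ {a : Fin 12 → K} {q : P11.Point K}, q ∈ variety K (hypIdeal k) → q ∈ O →
      P11.Represents a q → (∀ i, a i ≠ 0) ∧ ∃ c : K, c ≠ 0 ∧ phiVal (psiVal a) = c • a := by
    intro a q hV hO ha
    have ha0 := (hX0 a).1 (hO a ha)
    exact ⟨ha0, exists_phiVal_psiVal (fun f hf => hV a ha f (sup_le_hypIdeal k hf)) ha0⟩
  have hbwd : ∀ q : ↥(variety K (hypIdeal k) ∩ O), ∃ p : U,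
      P11.MapsTo FxP1xP1xP1 (psi k) q.1 p.1 := by
    rintro ⟨q, hV, hO⟩
    obtain ⟨a, ha⟩ := exists_represents q
    obtain ⟨ha0, c, hc, he⟩ := hcomp hV hO ha
    have hp : FxP1xP1xP1.Represents (psiVal a)
      (Quotient.mk (FxP1xP1xP1.setoid K) ⟨_, coordF _ ha0⟩) := ⟨_, rfl⟩
    refine ⟨⟨_, hp.mem_basicOpen hphi ((hphi0 _).2 fun i => ?_)⟩,
      (isFormTuple_psi k).mapsTo ha (by rwa [aeval_psi])⟩
    rw [he]
    exact mul_ne_zero hc (ha0 i)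
  choose f hf using hfwd
  choose g hg using hbwd
  have hgf : ∀ p, g (f p) = p := by
    rintro ⟨p, hp⟩
    obtain ⟨u, hu⟩ := exists_represents p
    have h1 := hf ⟨p, hp⟩ u hu
    rw [haeval] at h1
    have h2 := hg (f ⟨p, hp⟩) _ h1
    rw [aeval_psi] at h2
    obtain ⟨t, ht⟩ := exists_psiVal_phiVal ((hphi0 u).1 (hp u hu))
    rw [ht] at h2
    exact Subtype.ext (h2.unique (hu.smul t))
  have hfg : ∀ q, f (g q) = q := by
    rintro ⟨q, hV, hO⟩
    obtain ⟨a, ha⟩ := exists_represents q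
    obtain ⟨ha0, c, hc, he⟩ := hcomp hV hO ha
    have h1 := hg ⟨q, hV, hO⟩ a ha
    rw [aeval_psi] at h1
    have h2 := hf (g ⟨q, hV, hO⟩) _ h1
    rw [haeval, he] at h2
    have h3 := ha.smul fun _ => Units.mk0 c hc
    refine Subtype.ext (h2.unique ?_)
    convert h3 using 2 with s
    simp [P11, proj]
  let e : U ≃ ↥(variety K (hypIdeal k) ∩ O) := ⟨f, g, hgf, hfg⟩
  have hU : U.Nonempty := by
    have : CharZero K := charZero_of_injective_algebraMap (algebraMap k K).injective
    have hu : FxP1xP1xP1.IsCoord (coxVec (1 : K) 1 1 1 1 2 1 1 1 1) := by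
      rintro (i | ⟨⟩ | ⟨⟩ | ⟨⟩)
      · fin_cases i
        · exact ⟨.inl (.inl 0), rfl, one_ne_zero⟩
        · exact ⟨.inl (.inr 0), rfl, one_ne_zero⟩
      · exact ⟨.inr (.inl 0), rfl, one_ne_zero⟩
      · exact ⟨.inr (.inr (.inl 0)), rfl, one_ne_zero⟩
      · exact ⟨.inr (.inr (.inr 0)), rfl, one_ne_zero⟩
    have hp : FxP1xP1xP1.Represents _ (Quotient.mk (FxP1xP1xP1.setoid K) ⟨_, hu⟩) := ⟨hu, rfl⟩
    refine ⟨_, hp.mem_basicOpen hphi ((hphi0 _).2 fun i => ?_)⟩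
    exact phiVal_one_two_ne_zero i
  have hOU : (variety K (hypIdeal k) ∩ O).Nonempty := by
    obtain ⟨p, hp⟩ := hU
    exact ⟨_, (e ⟨p, hp⟩).2⟩
  refine ⟨isFormTuple_phi k, U, O, isZariskiOpen_basicOpen hphi, isZariskiOpen_basicOpen hX, hU,
    hOU, e, hf, fun p => ?_, fun q => ?_⟩
  · exact ⟨U, isZariskiOpen_basicOpen hphi, p.2, phi k, isFormTuple_phi k, fun q _ => hf q⟩
  · exact ⟨O, isZariskiOpen_basicOpen hX, q.2.2, psi k, isFormTuple_psi k, fun p _ => hg p⟩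

/-! ### Unirationality -/

/-- Substitution that turns the forms `phi` into forms on `ℙ⁹`. -/
def unirationalVec {R : Type*} [CommRing R] (x : Fin 10 → R) : CoxIndex → R :=
  -- The factor w₁² accounts for the degree (1, 2) of v₀; all forms then have degree 2 + 5 + 3 + 2 +
  -- 2 = 14.
  coxVec (x 0 * x 3 ^ 2) (x 1) (x 2) (x 3) (x 4) (x 5) (x 6) (x 7) (x 8) (x 9)

/-- Forms on `ℙ⁹` that define a dominant rational map to the hyperelliptic locus. -/
noncomputable def unirationalForms (k : Type*) [Field k] : Fin 12 → MvPolynomial (Fin 10) k :=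
  phiVal (unirationalVec X)

theorem aeval_unirationalForms (x : Fin 10 → K) :
    (fun s => aeval x (unirationalForms k s)) = phiVal (unirationalVec x) := by
  ext i
  rw [unirationalForms, ← aeval_phi (k := k), ← aeval_phi (k := k), ← AlgHom.comp_apply,
    comp_aeval]
  congr 2
  rw [funext_iff, forall_coxIndex]
  simp [unirationalVec, coxVec]

theorem isFormTuple_unirationalForms :
    (proj (Fin 10)).IsFormTuple P11 (unirationalForms k) := by
  have hX : ∀ i, IsWeightedHomogeneous (proj (Fin 10)).weight (X i : MvPolynomial (Fin 10) k) 1 :=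
    isWeightedHomogeneous_X k (proj (Fin 10)).weight
  refine ⟨fun _ _ => 14, fun i => ?_⟩
  refine (isWeightedHomogeneous_phiVal (((hX 0).mul ((hX 3).pow 2)).of_eq rfl) (hX 1) (hX 2) (hX 3)
    (hX 4) (hX 5) (hX 6) (hX 7) (hX 8) (hX 9) i).of_eq ?_
  ext
  simp [P11, proj]

theorem exists_mapsTo_unirationalForms [CharZero k] {f : Sa k} (hf : f ∉ hypIdeal k) :
    ∃ (p : (proj (Fin 10)).Point K) (q : P11.Point K) (a : Fin 12 → K),
      (proj (Fin 10)).MapsTo P11 (unirationalForms k) p q ∧ P11.Represents a q ∧ aeval a f ≠ 0 := by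
  have : CharZero K := charZero_of_injective_algebraMap (algebraMap k K).injective
  -- The form a₃₀ is divisible by w₁², so multiplying by X 2 secures w₁ ≠ 0, needed to solve for the
  -- substituted v₀, and also φ(u) ≠ 0.
  have hne : aeval (phi k) (f * X 2) ≠ 0 := fun h =>
    ((inferInstance : (hypIdeal k).IsPrime).mem_or_mem ((mem_hypIdeal k).2 h)).elim hf
      (X_notMem_hypIdeal k 2)
  obtain ⟨u, hu⟩ : ∃ u : CoxIndex → K, aeval u (aeval (phi k) (f * X 2)) ≠ 0 := by
    by_contra! hcon
    apply hne
    apply map_injective (algebraMap k K) (algebraMap k K).injective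
    refine MvPolynomial.funext fun u => ?_
    simpa [eval_map, aeval_def] using hcon u
  rw [← aeval_phiVal, map_mul, aeval_X] at hu
  have hfu := left_ne_zero_of_mul hu
  have h2 := right_ne_zero_of_mul hu
  have hw : u (.inl (.inr 1)) ≠ 0 := fun h => h2 (by simp [phiVal, phiMonomials, h])
  let x : Fin 10 → K := ![u (.inl (.inl 0)) / u (.inl (.inr 1)) ^ 2, u (.inl (.inl 1)),
    u (.inl (.inr 0)), u (.inl (.inr 1)), u (.inr (.inl 0)), u (.inr (.inl 1)),
    u (.inr (.inr (.inl 0))), u (.inr (.inr (.inl 1))), u (.inr (.inr (.inr 0))),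
    u (.inr (.inr (.inr 1)))]
  have hx : unirationalVec x = u := by
    refine .trans ?_ (eq_coxVec u).symm
    change coxVec (u (.inl (.inl 0)) / u (.inl (.inr 1)) ^ 2 * u (.inl (.inr 1)) ^ 2) _ _ _ _ _ _ _
      _ _ = _
    rw [div_mul_cancel₀ _ (pow_ne_zero 2 hw)]
    rfl
  have hxc : (proj (Fin 10)).IsCoord x := fun _ => ⟨3, rfl, hw⟩
  have hac : P11.IsCoord (phiVal u) := fun _ => ⟨2, rfl, h2⟩
  refine ⟨Quotient.mk _ ⟨x, hxc⟩, Quotient.mk _ ⟨_, hac⟩, phiVal u,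
    isFormTuple_unirationalForms.mapsTo ⟨hxc, rfl⟩ ?_, ⟨hac, rfl⟩, hfu⟩
  rw [aeval_unirationalForms, hx]
  exact ⟨hac, rfl⟩

theorem isUnirational_variety [CharZero k] :
    CoxData.IsUnirational k P11 (variety K (hypIdeal k)) := by
  refine ⟨9, unirationalForms k, isFormTuple_unirationalForms, ?_, fun p q h => ?_, ?_⟩
  · obtain ⟨p, q, -, h, -⟩ := exists_mapsTo_unirationalForms (K := K) (X_notMem_hypIdeal k 0)
    exact ⟨p, q, h⟩
  · obtain ⟨x, hx⟩ := exists_represents p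
    have := h x hx
    rw [aeval_unirationalForms] at this
    exact mem_variety_of_represents this
  · rintro _ ⟨E, hE, rfl⟩ ⟨q, hV, f, hfE, hf⟩
    obtain ⟨a, ha⟩ := exists_represents q
    obtain ⟨d, hd⟩ := hE f hfE
    obtain ⟨p, q', b, h, hb, hbf⟩ := exists_mapsTo_unirationalForms (K := K)
      (fun hfJ => hf a ha (hV a ha f hfJ))
    exact ⟨p, q', h, f, hfE, fun y hy => hb.aeval_ne_zero hy hd hbf⟩

end Birational

end HypLocus

theorem theorem2p9 (k : Type u) [Field k] [CharZero k]
    (K : Type v) [Field K] [IsAlgClosed K] [Algebra k K] :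
    (∃! J : Ideal (HypLocus.Sa k), HypLocus.IsHypIdeal k J) ∧
    ∀ J : Ideal (HypLocus.Sa k), HypLocus.IsHypIdeal k J →
      (∀ (p : HypLocus.FxP1xP1xP1.Point K) (q : HypLocus.P11.Point K),
        HypLocus.FxP1xP1xP1.MapsTo HypLocus.P11 (HypLocus.phi k) p q →
          q ∈ HypLocus.variety K J) ∧
      HypLocus.FxP1xP1xP1.IsBirationalMap HypLocus.P11 (HypLocus.phi k)
        (HypLocus.variety K J) ∧
      CoxData.IsUnirational k HypLocus.P11 (HypLocus.variety K J) := by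
  refine ⟨⟨HypLocus.hypIdeal k, HypLocus.isHypIdeal_iff.2 rfl,
    fun J hJ => HypLocus.isHypIdeal_iff.1 hJ⟩, fun J hJ => ?_⟩
  obtain rfl := HypLocus.isHypIdeal_iff.1 hJ
  refine ⟨fun p q h => ?_, HypLocus.isBirationalMap_phi, HypLocus.isUnirational_variety⟩
  obtain ⟨u, hu⟩ := CoxData.exists_represents p
  have hq := h u hu
  rw [funext (HypLocus.aeval_phi u)] at hq
  exact HypLocus.mem_variety_of_represents hq
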